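/- For even $n\ge 2$ consider the supermarket model on the dynamic perfect matching of $[n]=\{1,\dots,n\}$, with arrival rate $\lambda>0$ and graph speed $\kappa\ge 0$. This is the continuous-time Markov chain whose state consists of a queue length $Q^{(v)}\in\{0,1,2,\dots\}$ at every $v\in[n]$ and a perfect matching of $[n]$, with the following dynamics, independently at every vertex $v$. At rate $\lambda$ a task arrives at $v$ and joins the shorter of the queues at $v$ and at its current partner, a uniform one of the two in case of a tie. At rate $1$ one task is removed from the queue at $v$ if that queue is nonempty. At rate $\kappa$ the vertex $v$ picks a uniform $u\in[n]$ and swaps its membership in the matching with $u$: after the swap $v$ is matched to the former partner of $u$, and $u$ to that of $v$; nothing changes if $u=v$ or if $u$ and $v$ are partners. There is an absolute constant $\lambda_0>0$ such that for all $0<\lambda<\lambda_0$ and all $\kappa\ge 0$ the following holds. For every even $n\ge2$ the chain has a stationary distribution, and the law $\pi=\pi^{(n)}_\kappa$ on $\{0,1,2,\dots\}$ of a single queue $Q^{(i)}$ at stationarity is uniquely determined and is the same for every $i\in[n]$. The pointwise limit $\eta_\kappa=\lim_{n\to\infty}\pi^{(n)}_\kappa$ (along even $n$) exists and is a probability distribution,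 and for every even $n\ge 2$ $$\operatorname{d}_{\rm TV}\big(\pi^{(n)}_\kappa,\eta_\kappa\big)\le\frac1n ,$$ where $\operatorname{d}_{\rm TV}(p,q)=\sup_{A}|p(A)-q(A)|$, the supremum being over all sets $A$ of non-negative integers. -/

import Mathlib

/-- A perfect matching of `{0, …, n-1}` (an equal partition into hyperedges of size two), encoded
by the map sending every vertex to its partner: a fixed-point-free involution. -/
def PerfectMatching (n : ℕ) : Type :=
  {σ : Equiv.Perm (Fin n) // (∀ v, σ (σ v) = v) ∧ ∀ v, σ v ≠ v}

namespace Supermarket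

/-- A state of the system: the queue length at every vertex, and the current matching. -/
abbrev State (n : ℕ) : Type := (Fin n → ℕ) × PerfectMatching n

/-- The vertices `u` and `v` swap their membership of the partition: `u` becomes the partner of the
former partner of `v` and conversely (nothing changes if `u = v` or if they are partners). -/
def swapMembership {n : ℕ} (u v : Fin n) (M : PerfectMatching n) : PerfectMatching n :=
  ⟨Equiv.swap u v * M.1 * Equiv.swap u v, by
    obtain ⟨σ, h1, h2⟩ := M
    refine ⟨fun w => ?_, fun w hw => ?_⟩
    · simp [h1]
    · apply h2 (Equiv.swap u v w)
      have := congrArg (Equiv.swap u v) hw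
      simpa using this⟩

/-- The neighbourhood of `v`: the vertex itself and its current partner. -/
def nbhd {n : ℕ} (M : PerfectMatching n) (v : Fin n) : Finset (Fin n) := {v, M.1 v}

/-- The vertices carrying the shortest queues of the neighbourhood of `v`. -/
def shortest {n : ℕ} (s : State n) (v : Fin n) : Finset (Fin n) :=
  (nbhd s.2 v).filter fun u => ∀ w ∈ nbhd s.2 v, s.1 u ≤ s.1 w

/-- A task joins the queue at `u`. -/
def addTask {n : ℕ} (s : State n) (u : Fin n) : State n :=
  (Function.update s.1 u (s.1 u + 1), s.2)

/-- The server at `v` completes a task, if its queue is nonempty. -/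
def serve {n : ℕ} (s : State n) (v : Fin n) : State n :=
  (Function.update s.1 v (s.1 v - 1), s.2)

/-- The generator of the supermarket model on the dynamic perfect matching, with arrival rate `lam`
and graph speed `κ`. At every vertex `v` independently:
* at rate `lam` a task arrives and joins a uniform one of the shortest queues of the
  neighbourhood of `v`;
* at rate `1` the server at `v` completes a task;
* at rate `κ` the vertex `v` swaps its membership with that of a uniform vertex of all `n`. -/
noncomputable def generator (lam κ : ℝ) {n : ℕ} (f : State n → ℝ) (s : State n) : ℝ :=
  ∑ v : Fin n,
    (lam * (((shortest s v).card : ℝ)⁻¹ * ∑ u ∈ shortest s v, (f (addTask s u) - f s))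
      + (f (serve s v) - f s)
      + κ * ((n : ℝ)⁻¹ * ∑ u : Fin n, (f (s.1, swapMembership v u s.2) - f s)))

/-- `μ` is a stationary distribution of the continuous-time Markov chain: the generator of every
bounded function has mean zero. The total jump rate is bounded, so the generator is a
bounded operator `L` on bounded functions, the series converges absolutely, and the condition
is equivalent to `μ` being invariant under the transition semigroup `exp (t L)`. -/
def IsStationary (lam κ : ℝ) {n : ℕ} (μ : PMF (State n)) : Prop :=
  ∀ f : State n → ℝ, (∃ C : ℝ, ∀ s, |f s| ≤ C) →
    ∑' s, (μ s).toReal * generator lam κ f s = 0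

/-- `p` is the stationary distribution of a single queue in the system of size `n`: a stationary
distribution of the system exists, and under every such distribution the queue at every vertex
has law `p`. -/
def IsQueueLaw (lam κ : ℝ) (n : ℕ) (p : PMF ℕ) : Prop :=
  (∃ μ : PMF (State n), IsStationary lam κ μ) ∧
    ∀ μ : PMF (State n), IsStationary lam κ μ → ∀ i : Fin n, μ.map (fun s => s.1 i) = p

/-- Total variation distance of two probability distributions on `ℕ`. -/
noncomputable def tvDist (p q : PMF ℕ) : ℝ :=
  ⨆ A : Set ℕ, |(p.toMeasure A).toReal - (q.toMeasure A).toReal|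

end Supermarket

/-!
The joint tails of the queue lengths under a stationary distribution, conditioned on the matching,
satisfy a closed linear system: a task joining a queue makes it exceed `c` only if its length is
`c`, and then the tie-breaking is a condition on the tail of the partner's queue. Measured in the
weight `r ^ ∑ m`, the system obeys a maximum principle for small `lam`: departures dominate
arrivals, while swaps are an average over matchings and push a function towards `0` at the
matching where it is extremal, whatever `κ` is. This gives uniqueness, and after averaging over
relabellings also that all queues have the same law; existence follows from a Lyapunov function and
Cesàro means of the uniformized chain.

In an infinite system the partner found by a swap is independent of everything else, so the joint
tail of a matched pair solves a nonlinear equation, which is a contraction for small `lam`. The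
product of its solution over the matched pairs satisfies the linear system for `n` queues up to
an error of order `1 / n` from the swaps, and the maximum principle turns this into a bound on the
distance of the two laws.
-/

namespace Supermarket

open Filter Topology

section ProbabilityMassFunctions

variable {α : Type*}

theorem hasSum_toReal (μ : PMF α) : HasSum (fun x => (μ x).toReal) 1 := by
  simpa only [← ENNReal.tsum_toReal_eq μ.apply_ne_top, μ.tsum_coe, ENNReal.toReal_one] using
    ENNReal.hasSum_toReal μ.tsum_coe_ne_top

theorem summable_toReal_mul (μ : PMF α) {f : α → ℝ} {C : ℝ} (hf : ∀ x, |f x| ≤ C) :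
    Summable fun x => (μ x).toReal * f x := by
  refine Summable.of_norm_bounded ((hasSum_toReal μ).summable.mul_right C) fun x => ?_
  rw [Real.norm_eq_abs, abs_mul, abs_of_nonneg ENNReal.toReal_nonneg]
  exact mul_le_mul_of_nonneg_left (hf x) ENNReal.toReal_nonneg

theorem exists_pmf_toReal_eq {p : α → ℝ} (hp : ∀ x, 0 ≤ p x) (h : HasSum p 1) :
    ∃ μ : PMF α, ∀ x, (μ x).toReal = p x := by
  have hsum : ∑' x, ENNReal.ofReal (p x) = 1 := by
    rw [← ENNReal.ofReal_tsum_of_nonneg hp h.summable, h.tsum_eq, ENNReal.ofReal_one]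
  exact ⟨⟨_, hsum ▸ ENNReal.summable.hasSum⟩, fun x => ENNReal.toReal_ofReal (hp x)⟩

end ProbabilityMassFunctions

section WeightedBounds

variable {ι : Type*} {w : ι → ℝ}

theorem abs_le_of_self_improving (hw : ∀ i, 0 < w i) {f : ι → ℝ} {A c ε : ℝ} (hc : c < 1)
    (hA : ∀ i, |f i| ≤ A * w i)
    (h : ∀ S, 0 ≤ S → (∀ i, |f i| ≤ S * w i) → ∀ i, |f i| ≤ (c * S + ε) * w i) (i : ι) :
    |f i| ≤ ε / (1 - c) * w i := by
  set g : ι → ℝ := fun i => |f i| / w i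
  have hle_iff : ∀ S i, g i ≤ S ↔ |f i| ≤ S * w i := fun S i => div_le_iff₀ (hw i)
  have hbdd : BddAbove (Set.range g) := ⟨A, by rintro _ ⟨i, rfl⟩; exact (hle_iff A i).2 (hA i)⟩
  have hsup : ∀ i, |f i| ≤ (⨆ j, g j) * w i := fun i => (hle_iff _ i).1 (le_ciSup hbdd i)
  have hsup₀ : 0 ≤ ⨆ j, g j :=
    Real.iSup_nonneg fun j => div_nonneg (abs_nonneg _) (hw j).le
  have : Nonempty ι := ⟨i⟩
  have himproved : ⨆ j, g j ≤ c * (⨆ j, g j) + ε :=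
    ciSup_le fun j => (hle_iff _ j).2 (h _ hsup₀ hsup j)
  refine (hsup i).trans (mul_le_mul_of_nonneg_right ?_ (hw i).le)
  rw [le_div_iff₀ (sub_pos.2 hc)]
  linarith

theorem exists_fixedPoint_of_weighted_contraction {T : (ι → ℝ) → ι → ℝ} {C : Set (ι → ℝ)}
    (hC : IsClosed C) (hTC : Set.MapsTo T C C) {K d : ℝ} (hK₀ : 0 ≤ K) (hK : K < 1)
    (hT : ∀ f ∈ C, ∀ g ∈ C, ∀ S, (∀ i, |f i - g i| ≤ S * w i) →
      ∀ i, |T f i - T g i| ≤ K * S * w i)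
    {f₀ : ι → ℝ} (hf₀ : f₀ ∈ C) (hd : ∀ i, |f₀ i - T f₀ i| ≤ d * w i) : ∃ f ∈ C, T f = f := by
  have hmem : ∀ k, T^[k] f₀ ∈ C := fun k => hTC.iterate k hf₀
  have hstep : ∀ k i, |T^[k] f₀ i - T^[k + 1] f₀ i| ≤ d * K ^ k * w i := by
    intro k
    induction k with
    | zero => simpa using hd
    | succ k ih =>
      intro i
      have h := hT _ (hmem k) _ (hmem (k + 1)) _ ih i
      rw [← Function.iterate_succ_apply' T, ← Function.iterate_succ_apply' T] at h
      exact h.trans_eq (by ring)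
  have hdist : ∀ i k, dist (T^[k] f₀ i) (T^[k + 1] f₀ i) ≤ d * w i * K ^ k := fun i k => by
    rw [Real.dist_eq, mul_right_comm]; exact hstep k i
  choose f hf using fun i =>
    cauchySeq_tendsto_of_complete (cauchySeq_of_le_geometric K (d * w i) hK (hdist i))
  have hfC : f ∈ C := hC.mem_of_tendsto (tendsto_pi_nhds.2 hf) (Eventually.of_forall hmem)
  have hrate : ∀ k i, |T^[k] f₀ i - f i| ≤ d * K ^ k / (1 - K) * w i := fun k i => by
    rw [← Real.dist_eq]
    exact (dist_le_of_le_geometric_of_tendsto K (d * w i) hK (hdist i) (hf i) k).trans_eq (by ring)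
  have himage : ∀ i, Tendsto (fun k => T^[k + 1] f₀ i) atTop (𝓝 (T f i)) := fun i => by
    refine tendsto_iff_dist_tendsto_zero.2 (squeeze_zero (fun _ => dist_nonneg)
      (g := fun k => K * (d * K ^ k / (1 - K)) * w i) (fun k => ?_) ?_)
    · rw [Function.iterate_succ_apply', Real.dist_eq]
      exact hT _ (hmem k) f hfC _ (hrate k) i
    · simpa using (((tendsto_pow_atTop_nhds_zero_of_lt_one hK₀ hK).const_mul d).div_const
        (1 - K)).const_mul K |>.mul_const (w i)
  exact ⟨f, hfC, funext fun i =>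
    tendsto_nhds_unique (himage i) ((hf i).comp (tendsto_add_atTop_nat 1))⟩

end WeightedBounds

section MarkovOperators

variable {α : Type*}

/-- A mean on the real functions on `α`: a monotone linear functional of total mass one. Unlike the
expectation under a probability distribution it need not be countably additive. -/
structure IsMean (φ : (α → ℝ) →ₗ[ℝ] ℝ) : Prop where
  monotone : Monotone φ
  map_one : φ 1 = 1

theorem IsMean.map_const {φ : (α → ℝ) →ₗ[ℝ] ℝ} (hφ : IsMean φ) (c : ℝ) : φ (fun _ => c) = c := by
  have h : (fun _ : α => c) = c • 1 := by ext; simp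
  rw [h, map_smul, hφ.map_one, smul_eq_mul, mul_one]

theorem IsMean.abs_le_of_abs_le {φ : (α → ℝ) →ₗ[ℝ] ℝ} (hφ : IsMean φ) {f g : α → ℝ}
    (h : ∀ x, |f x| ≤ g x) : |φ f| ≤ φ g := by
  have hlower := hφ.monotone (show -g ≤ f from fun x => (abs_le.1 (h x)).1)
  rw [map_neg] at hlower
  exact abs_le.2 ⟨hlower, hφ.monotone fun x => (abs_le.1 (h x)).2⟩

theorem IsMean.abs_le_const {φ : (α → ℝ) →ₗ[ℝ] ℝ} (hφ : IsMean φ) {f : α → ℝ} {C : ℝ}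
    (h : ∀ x, |f x| ≤ C) : |φ f| ≤ C :=
  (hφ.abs_le_of_abs_le h).trans_eq (hφ.map_const C)

open Classical in
theorem IsMean.abs_sub_sum_single_le {φ : (α → ℝ) →ₗ[ℝ] ℝ} (hφ : IsMean φ) {V : α → ℝ}
    (hV : 0 ≤ V) {f : α → ℝ} {C : ℝ} (hC : 0 ≤ C) (hf : ∀ x, |f x| ≤ C) {c : ℝ} (hc : 0 < c)
    {S : Finset α} (hS : ∀ x, V x ≤ c → x ∈ S) :
    |φ f - ∑ x ∈ S, f x * φ (Pi.single x 1)| ≤ C / c * φ V := by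
  set g : α → ℝ := f - ∑ x ∈ S, f x • Pi.single x 1 with hg
  have hg_apply : ∀ x, g x = if x ∈ S then 0 else f x := by
    intro x
    simp only [hg, Pi.sub_apply, Finset.sum_apply, Pi.smul_apply, Pi.single_apply, smul_eq_mul,
      mul_ite, mul_one, mul_zero, Finset.sum_ite_eq]
    split_ifs <;> simp
  have hg_le : ∀ x, |g x| ≤ ((C / c) • V) x := by
    intro x
    rw [hg_apply, Pi.smul_apply, smul_eq_mul]
    split_ifs with hx
    · simpa using mul_nonneg (div_nonneg hC hc.le) (hV x)
    · have hVx : c < V x := not_le.1 (mt (hS x) hx)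
      rw [div_mul_eq_mul_div, le_div_iff₀ hc]
      exact mul_le_mul (hf x) hVx.le hc.le hC
  simpa [hg] using hφ.abs_le_of_abs_le hg_le

open Classical in
theorem hasSum_of_tendsto_isMean {ι : Type*} {U : Filter ι} [U.NeBot]
    {φ : ι → (α → ℝ) →ₗ[ℝ] ℝ} (hφ : ∀ i, IsMean (φ i)) {V : α → ℝ} (hV : 0 ≤ V)
    (hfin : ∀ c, {x | V x ≤ c}.Finite) {K : ℝ} (hK : ∀ i, φ i V ≤ K) {p : α → ℝ}
    (hp : ∀ x, Tendsto (fun i => φ i (Pi.single x 1)) U (𝓝 (p x))) {f : α → ℝ} {C : ℝ}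
    (hf : ∀ x, |f x| ≤ C) {l : ℝ} (hl : Tendsto (fun i => φ i f) U (𝓝 l)) :
    HasSum (fun x => p x * f x) l := by
  obtain ⟨i⟩ : Nonempty ι := U.nonempty_of_neBot
  have hC : 0 ≤ C := (abs_nonneg _).trans ((hφ i).abs_le_const hf)
  have hK0 : 0 ≤ K := by simpa using ((hφ i).monotone hV).trans (hK i)
  refine Metric.tendsto_atTop.2 fun ε hε => ?_
  set c : ℝ := (C * K + 1) / ε with hc
  have hc0 : 0 < c := by positivity
  refine ⟨(hfin c).toFinset, fun S hS => ?_⟩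
  have herr : |l - ∑ x ∈ S, f x * p x| ≤ C / c * K := by
    refine le_of_tendsto (hl.sub (tendsto_finsetSum S fun x _ => (hp x).const_mul (f x))).abs
      (Eventually.of_forall fun j => ?_)
    refine ((hφ j).abs_sub_sum_single_le hV hC hf hc0 fun x hx => hS (by simpa using hx)).trans ?_
    exact mul_le_mul_of_nonneg_left (hK j) (by positivity)
  rw [Real.dist_eq, abs_sub_comm]
  simp only [mul_comm (p _)]
  refine herr.trans_lt ?_
  rw [div_mul_eq_mul_div, div_lt_iff₀ hc0, hc, mul_div_cancel₀ _ hε.ne']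
  exact lt_add_one _

theorem exists_tendsto_of_abs_le {ι : Type*} (U : Ultrafilter ι) {a : ι → ℝ} {C : ℝ}
    (h : ∀ i, |a i| ≤ C) : ∃ l, Tendsto a U (𝓝 l) := by
  obtain ⟨l, -, hl⟩ := (isCompact_Icc (a := -C) (b := C)).ultrafilter_le_nhds (U.map a) <| by
    rw [le_principal_iff, Ultrafilter.coe_map, mem_map]
    exact univ_mem' fun i => abs_le.1 (h i)
  exact ⟨l, hl⟩

/- The finite sublevel sets of `V` make the family tight, so no mass escapes along `U`. -/
open Classical in
theorem exists_pmf_tendsto_of_isMean {ι : Type*} (U : Ultrafilter ι)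
    {φ : ι → (α → ℝ) →ₗ[ℝ] ℝ} (hφ : ∀ i, IsMean (φ i)) {V : α → ℝ} (hV : 0 ≤ V)
    (hfin : ∀ c, {x | V x ≤ c}.Finite) {K : ℝ} (hK : ∀ i, φ i V ≤ K) :
    ∃ μ : PMF α, ∀ f : α → ℝ, (∃ C, ∀ x, |f x| ≤ C) →
      Tendsto (fun i => φ i f) U (𝓝 (∑' x, (μ x).toReal * f x)) := by
  have hsingle : ∀ x y : α, |(Pi.single x 1 : α → ℝ) y| ≤ 1 := fun x y => by
    by_cases h : y = x <;> simp [h]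
  choose p hp using fun x =>
    exists_tendsto_of_abs_le U fun i => (hφ i).abs_le_const (hsingle x)
  have hp0 : ∀ x, 0 ≤ p x := fun x => ge_of_tendsto' (hp x) fun i => by
    simpa using (hφ i).monotone (Pi.single_nonneg.2 (zero_le_one' ℝ) : 0 ≤ Pi.single x 1)
  have hp1 : HasSum p 1 := by
    simpa using hasSum_of_tendsto_isMean hφ hV hfin hK hp (f := 1) (C := 1) (by simp)
      (by simp only [(hφ _).map_one, tendsto_const_nhds])
  obtain ⟨μ, hμ⟩ := exists_pmf_toReal_eq hp0 hp1
  refine ⟨μ, fun f ⟨C, hC⟩ => ?_⟩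
  obtain ⟨l, hl⟩ := exists_tendsto_of_abs_le U fun i => (hφ i).abs_le_const hC
  simp only [hμ, (hasSum_of_tendsto_isMean hφ hV hfin hK hp hC hl).tsum_eq, hl]

/-- A Markov operator: the action of a transition kernel on real functions. -/
structure IsMarkovOperator (P : (α → ℝ) →ₗ[ℝ] (α → ℝ)) : Prop where
  monotone : Monotone P
  map_one : P 1 = 1

theorem IsMarkovOperator.isMean_pow {P : (α → ℝ) →ₗ[ℝ] (α → ℝ)} (hP : IsMarkovOperator P) (k : ℕ)
    (x : α) : IsMean (LinearMap.proj x ∘ₗ (P ^ k)) where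
  monotone f g hfg := by
    simpa [Module.End.coe_pow] using hP.monotone.iterate k hfg x
  map_one := by
    simp [Module.End.coe_pow, Function.iterate_fixed hP.map_one]

theorem IsMarkovOperator.pow_le_of_le_smul {P : (α → ℝ) →ₗ[ℝ] (α → ℝ)} (hP : IsMarkovOperator P)
    {W : α → ℝ} {c : ℝ} (hc : 0 ≤ c) (h : P W ≤ c • W) (k : ℕ) : (P ^ k) W ≤ c ^ k • W := by
  induction k with
  | zero => simp
  | succ k ih =>
    calc (P ^ (k + 1)) W = P ((P ^ k) W) := by rw [pow_succ']; rfl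
      _ ≤ P (c ^ k • W) := hP.monotone ih
      _ = c ^ k • P W := map_smul _ _ _
      _ ≤ c ^ k • (c • W) := smul_le_smul_of_nonneg_left h (pow_nonneg hc k)
      _ = c ^ (k + 1) • W := by rw [smul_smul, pow_succ]

theorem IsMarkovOperator.pow_le_add_of_drift {P : (α → ℝ) →ₗ[ℝ] (α → ℝ)} (hP : IsMarkovOperator P)
    {V : α → ℝ} (hV : 0 ≤ V) {t K : ℝ} (ht : 0 ≤ t) (ht1 : t ≤ 1) (hK : 0 ≤ K)
    (h : ∀ x, P V x ≤ (1 - t) * V x + t * K) (k : ℕ) (x : α) : (P ^ k) V x ≤ V x + K := by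
  have hpow : ∀ j, (P ^ j) (K • 1) = K • 1 := fun j => by
    rw [map_smul, Module.End.coe_pow, Function.iterate_fixed hP.map_one]
  -- The drift condition says that `P` contracts `V - K`.
  have hW : P (V - K • 1) ≤ (1 - t) • (V - K • 1) := by
    intro y
    rw [map_sub, ← pow_one P, hpow, pow_one]
    simp only [Pi.sub_apply, Pi.smul_apply, Pi.one_apply, smul_eq_mul]
    linarith [h y]
  have hk := hP.pow_le_of_le_smul (sub_nonneg.2 ht1) hW k x
  rw [map_sub, hpow] at hk
  simp only [Pi.sub_apply, Pi.smul_apply, Pi.one_apply, smul_eq_mul, mul_one] at hk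
  have hV' : (1 - t) ^ k * V x ≤ V x :=
    mul_le_of_le_one_left (hV x) (pow_le_one₀ (sub_nonneg.2 ht1) (sub_le_self 1 ht))
  have hK' : 0 ≤ (1 - t) ^ k * K := mul_nonneg (pow_nonneg (sub_nonneg.2 ht1) k) hK
  linarith

/-- The mean over the first `N + 1` steps of the Markov chain with kernel `P` started at `x`. -/
noncomputable def cesaroMean (P : (α → ℝ) →ₗ[ℝ] (α → ℝ)) (x : α) (N : ℕ) : (α → ℝ) →ₗ[ℝ] ℝ :=
  ((N : ℝ) + 1)⁻¹ • ∑ k ∈ Finset.range (N + 1), LinearMap.proj x ∘ₗ (P ^ k)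

theorem cesaroMean_apply (P : (α → ℝ) →ₗ[ℝ] (α → ℝ)) (x : α) (N : ℕ) (f : α → ℝ) :
    cesaroMean P x N f = ((N : ℝ) + 1)⁻¹ * ∑ k ∈ Finset.range (N + 1), (P ^ k) f x := by
  simp [cesaroMean]

theorem cesaroMean_le {P : (α → ℝ) →ₗ[ℝ] (α → ℝ)} {x : α} {f : α → ℝ} {c : ℝ}
    (h : ∀ k, (P ^ k) f x ≤ c) (N : ℕ) : cesaroMean P x N f ≤ c := by
  rw [cesaroMean_apply, inv_mul_le_iff₀ (by positivity)]
  simpa using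
    Finset.sum_le_card_nsmul (Finset.range (N + 1)) (fun k => (P ^ k) f x) c fun k _ => h k

theorem IsMarkovOperator.isMean_cesaroMean {P : (α → ℝ) →ₗ[ℝ] (α → ℝ)} (hP : IsMarkovOperator P)
    (x : α) (N : ℕ) : IsMean (cesaroMean P x N) where
  monotone f g hfg := by
    simp only [cesaroMean_apply]
    gcongr with k
    exact (hP.isMean_pow k x).monotone hfg
  map_one := by
    have hone : ∀ k, (P ^ k) 1 x = 1 := fun k => (hP.isMean_pow k x).map_one
    rw [cesaroMean_apply]
    simp only [hone, Finset.sum_const, Finset.card_range, nsmul_eq_mul, mul_one, Nat.cast_add,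
      Nat.cast_one]
    exact inv_mul_cancel₀ (by positivity)

theorem IsMarkovOperator.abs_cesaroMean_map_sub_le {P : (α → ℝ) →ₗ[ℝ] (α → ℝ)}
    (hP : IsMarkovOperator P) (x : α) (N : ℕ) {f : α → ℝ} {C : ℝ} (hf : ∀ y, |f y| ≤ C) :
    |cesaroMean P x N (P f - f)| ≤ ((N : ℝ) + 1)⁻¹ * (C + C) := by
  have hterm : ∀ k, (P ^ k) (P f - f) x = (P ^ (k + 1)) f x - (P ^ k) f x := fun k => by
    rw [map_sub, pow_succ]; rfl
  rw [cesaroMean_apply]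
  simp only [hterm]
  rw [Finset.sum_range_sub fun k => (P ^ k) f x, abs_mul, abs_of_pos (by positivity)]
  gcongr
  exact (abs_sub _ _).trans
    (add_le_add ((hP.isMean_pow (N + 1) x).abs_le_const hf) ((hP.isMean_pow 0 x).abs_le_const hf))

theorem IsMarkovOperator.exists_invariant_pmf {P : (α → ℝ) →ₗ[ℝ] (α → ℝ)}
    (hP : IsMarkovOperator P) {V : α → ℝ} (hV : 0 ≤ V) (hfin : ∀ c, {x | V x ≤ c}.Finite) {x : α}
    {K : ℝ} (hK : ∀ k, (P ^ k) V x ≤ K) :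
    ∃ μ : PMF α, ∀ f : α → ℝ, (∃ C, ∀ y, |f y| ≤ C) →
      ∑' y, (μ y).toReal * (P f - f) y = 0 := by
  obtain ⟨μ, hμ⟩ := exists_pmf_tendsto_of_isMean (hyperfilter ℕ)
    (fun N => hP.isMean_cesaroMean x N) hV hfin fun N => cesaroMean_le hK N
  refine ⟨μ, fun f ⟨C, hC⟩ => ?_⟩
  have hPf : ∀ y, |(P f - f) y| ≤ C + C := fun y =>
    (abs_sub _ _).trans (add_le_add (by simpa using (hP.isMean_pow 1 y).abs_le_const hC) (hC y))
  refine tendsto_nhds_unique (hμ _ ⟨_, hPf⟩)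
    (squeeze_zero_norm (fun N => hP.abs_cesaroMean_map_sub_le x N hC) ?_)
  have hinv : Tendsto (fun N : ℕ => ((N : ℝ) + 1)⁻¹) (hyperfilter ℕ) (𝓝 0) := by
    simpa only [one_div] using
      (tendsto_one_div_add_atTop_nhds_zero_nat (𝕜 := ℝ)).mono_left Nat.hyperfilter_le_atTop
  simpa using hinv.mul_const (C + C)

/-- The generator of a Markov jump process whose jump rates are at most `r`: constants are in its
kernel and `L + r` is a positive operator. -/
structure IsJumpGenerator (r : ℝ) (L : (α → ℝ) →ₗ[ℝ] (α → ℝ)) : Prop where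
  map_one : L 1 = 0
  monotone : Monotone (L + r • (LinearMap.id : (α → ℝ) →ₗ[ℝ] (α → ℝ)))

theorem IsJumpGenerator.map_const {r : ℝ} {L : (α → ℝ) →ₗ[ℝ] (α → ℝ)} (hL : IsJumpGenerator r L)
    (c : ℝ) : L (fun _ => c) = 0 := by
  have h : (fun _ : α => c) = c • 1 := by ext; simp
  rw [h, map_smul, hL.map_one, smul_zero]

theorem IsJumpGenerator.mono {r r' : ℝ} (h : r ≤ r') {L : (α → ℝ) →ₗ[ℝ] (α → ℝ)}
    (hL : IsJumpGenerator r L) : IsJumpGenerator r' L where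
  map_one := hL.map_one
  monotone f g hfg x := by
    have h₁ := hL.monotone hfg x
    have h₂ := mul_le_mul_of_nonneg_left (hfg x) (sub_nonneg.2 h)
    simp only [LinearMap.add_apply, LinearMap.smul_apply, LinearMap.id_apply, Pi.add_apply,
      Pi.smul_apply, smul_eq_mul] at h₁ ⊢
    linarith

theorem IsJumpGenerator.apply_le_of_le_of_eq {r : ℝ} {L : (α → ℝ) →ₗ[ℝ] (α → ℝ)}
    (hL : IsJumpGenerator r L) {f g : α → ℝ} (hfg : f ≤ g) {x : α} (hx : f x = g x) :
    L f x ≤ L g x := by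
  simpa [hx] using hL.monotone hfg x

theorem IsJumpGenerator.rate_nonneg {r : ℝ} {L : (α → ℝ) →ₗ[ℝ] (α → ℝ)}
    (hL : IsJumpGenerator r L) (x : α) : 0 ≤ r := by
  simpa [hL.map_one] using hL.monotone (zero_le_one' (α → ℝ)) x

theorem IsJumpGenerator.abs_apply_le {r : ℝ} {L : (α → ℝ) →ₗ[ℝ] (α → ℝ)}
    (hL : IsJumpGenerator r L) {f : α → ℝ} {C : ℝ} (hf : ∀ x, |f x| ≤ C) (x : α) :
    |L f x| ≤ 2 * r * C := by
  have hupper := hL.monotone (show f ≤ fun _ => C from fun y => (abs_le.1 (hf y)).2) x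
  have hlower := hL.monotone (show (fun _ => -C) ≤ f from fun y => (abs_le.1 (hf y)).1) x
  simp only [LinearMap.add_apply, LinearMap.smul_apply, LinearMap.id_apply, Pi.add_apply,
    Pi.smul_apply, smul_eq_mul, hL.map_const, Pi.zero_apply, zero_add] at hupper hlower
  obtain ⟨hf₁, hf₂⟩ := abs_le.1 (hf x)
  have h₁ := mul_le_mul_of_nonneg_left hf₁ (hL.rate_nonneg x)
  have h₂ := mul_le_mul_of_nonneg_left hf₂ (hL.rate_nonneg x)
  exact abs_le.2 ⟨by linarith, by linarith⟩

theorem IsJumpGenerator.isMarkovOperator {r : ℝ} (hr : 0 < r) {L : (α → ℝ) →ₗ[ℝ] (α → ℝ)}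
    (hL : IsJumpGenerator r L) : IsMarkovOperator (LinearMap.id + r⁻¹ • L) where
  monotone f g hfg := by
    have h : LinearMap.id + r⁻¹ • L = r⁻¹ • (L + r • LinearMap.id) := by
      rw [smul_add, smul_smul, inv_mul_cancel₀ hr.ne', one_smul, add_comm]
    rw [h]
    exact smul_le_smul_of_nonneg_left (hL.monotone hfg) (inv_nonneg.2 hr.le)
  map_one := by simp [hL.map_one]

theorem IsJumpGenerator.exists_stationary_pmf [Nonempty α] {r : ℝ} {L : (α → ℝ) →ₗ[ℝ] (α → ℝ)}
    (hL : IsJumpGenerator r L) {V : α → ℝ} (hV : 0 ≤ V) (hfin : ∀ c, {x | V x ≤ c}.Finite)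
    {a b : ℝ} (ha : 0 < a) (hb : 0 ≤ b) (hdrift : ∀ x, L V x ≤ b - a * V x) :
    ∃ μ : PMF α, ∀ f : α → ℝ, (∃ C, ∀ x, |f x| ≤ C) → ∑' x, (μ x).toReal * L f x = 0 := by
  have hR : 0 < max r a := lt_max_of_lt_right ha
  have hP := (hL.mono (le_max_left r a)).isMarkovOperator hR
  set P := LinearMap.id + (max r a)⁻¹ • L with hP_def
  have hPV : ∀ x, P V x ≤ (1 - a / max r a) * V x + a / max r a * (b / a) := by
    intro x
    have h := mul_le_mul_of_nonneg_left (hdrift x) (inv_nonneg.2 hR.le)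
    have e : (1 - a / max r a) * V x + a / max r a * (b / a)
        = V x + (max r a)⁻¹ * (b - a * V x) := by field_simp; ring
    rw [e]
    simpa [hP_def] using h
  obtain ⟨μ, hμ⟩ := hP.exists_invariant_pmf hV hfin (x := Classical.arbitrary α) fun k =>
    hP.pow_le_add_of_drift hV (by positivity) ((div_le_one hR).2 (le_max_right r a))
      (by positivity : 0 ≤ b / a) hPV k _
  refine ⟨μ, fun f hf => ?_⟩
  have h : ∑' x, (max r a)⁻¹ * ((μ x).toReal * L f x) = 0 := by
    simpa [hP_def, mul_left_comm] using hμ f hf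
  rw [tsum_mul_left] at h
  exact (mul_eq_zero.1 h).resolve_left (inv_ne_zero hR.ne')

/- `V` itself need not be bounded, so stationarity is tested on the truncations `min V K`. -/
theorem IsJumpGenerator.sum_stationary_mul_le {r : ℝ} {L : (α → ℝ) →ₗ[ℝ] (α → ℝ)}
    (hL : IsJumpGenerator r L) {V : α → ℝ} (hV : 0 ≤ V) {a b : ℝ} (ha : 0 < a) (hb : 0 ≤ b)
    (hdrift : ∀ x, L V x ≤ b - a * V x) {μ : PMF α}
    (hμ : ∀ f : α → ℝ, (∃ C, ∀ x, |f x| ≤ C) → ∑' x, (μ x).toReal * L f x = 0) (S : Finset α) :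
    ∑ x ∈ S, (μ x).toReal * V x ≤ b / a := by
  set K := ∑ x ∈ S, V x
  have hVS : ∀ x ∈ S, V x ≤ K := fun x hx => Finset.single_le_sum (fun y _ => hV y) hx
  have hK0 : 0 ≤ K := Finset.sum_nonneg fun x _ => hV x
  set f : α → ℝ := fun x => min (V x) K
  have hf : ∀ x, |f x| ≤ K := fun x => by
    rw [abs_of_nonneg (le_min (hV x) hK0)]; exact min_le_right _ _
  set W : α → ℝ := {x | V x ≤ K}.indicator V with hW_def
  have hW0 : 0 ≤ W := fun x => Set.indicator_nonneg (fun y _ => hV y) x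
  have hW : ∀ x, |W x| ≤ K := fun x => by
    rw [abs_of_nonneg (hW0 x)]
    exact Set.indicator_apply_le' (fun hx => hx) fun _ => hK0
  have hLf : ∀ x, L f x ≤ b - a * W x := by
    intro x
    by_cases hx : V x ≤ K
    · rw [hW_def, Set.indicator_of_mem (show x ∈ {x | V x ≤ K} from hx)]
      exact (hL.apply_le_of_le_of_eq (fun y => min_le_left _ _) (min_eq_left hx)).trans (hdrift x)
    · rw [hW_def, Set.indicator_of_notMem (show x ∉ {x | V x ≤ K} from hx), mul_zero, sub_zero]
      have h := hL.apply_le_of_le_of_eq (f := f) (g := fun _ => K) (fun y => min_le_right _ _)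
        (min_eq_right (not_le.1 hx).le)
      rw [hL.map_const] at h
      exact h.trans hb
  have hWsum := summable_toReal_mul μ hW
  have hbW : HasSum (fun x => (μ x).toReal * (b - a * W x))
      (1 * b - a * ∑' x, (μ x).toReal * W x) :=
    (((hasSum_toReal μ).mul_right b).sub (hWsum.hasSum.mul_left a)).congr_fun fun x => by ring
  have hmean : 0 ≤ 1 * b - a * ∑' x, (μ x).toReal * W x := by
    rw [← hμ f ⟨K, hf⟩, ← hbW.tsum_eq]
    exact (summable_toReal_mul μ (hL.abs_apply_le hf)).tsum_le_tsum
      (fun x => mul_le_mul_of_nonneg_left (hLf x) ENNReal.toReal_nonneg) hbW.summable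
  calc ∑ x ∈ S, (μ x).toReal * V x = ∑ x ∈ S, (μ x).toReal * W x :=
        Finset.sum_congr rfl fun x hx => by
          rw [hW_def, Set.indicator_of_mem (show x ∈ {x | V x ≤ K} from hVS x hx)]
    _ ≤ ∑' x, (μ x).toReal * W x :=
        hWsum.sum_le_tsum S fun x _ => mul_nonneg ENNReal.toReal_nonneg (hW0 x)
    _ ≤ b / a := by rw [le_div_iff₀' ha]; linarith

end MarkovOperators

section Drift

/-- The indicator that an entry of a multi-index is nonzero, so that it imposes a condition. -/
noncomputable def activeInd (a : ℕ) : ℝ := if a = 0 then 0 else 1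

@[simp] theorem activeInd_zero : activeInd 0 = 0 := if_pos rfl

theorem activeInd_of_ne_zero {a : ℕ} (ha : a ≠ 0) : activeInd a = 1 := if_neg ha

theorem activeInd_nonneg (a : ℕ) : 0 ≤ activeInd a := by unfold activeInd; split_ifs <;> simp

theorem activeInd_le_one (a : ℕ) : activeInd a ≤ 1 := by unfold activeInd; split_ifs <;> simp

theorem activeInd_mul_le_mul {a : ℕ} {x y : ℝ} (h : a ≠ 0 → x ≤ y) :
    activeInd a * x ≤ activeInd a * y := by
  rcases eq_or_ne a 0 with rfl | ha
  · simp
  · exact mul_le_mul_of_nonneg_left (h ha) (activeInd_nonneg a)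

/-- The contribution of the events at a queue to the drift of the joint tail function `F` of that
queue (first argument) and the queue of its partner, without the loss `-F a b` caused by service. -/
noncomputable def tailGain (lam : ℝ) (F : ℕ → ℕ → ℝ) (a b : ℕ) : ℝ :=
  activeInd a * (F (a + 1) b + lam * (F (a - 1) (max a b) + F (a - 1) (max (a - 1) b)
    - F a (max a b) - F a (max (a - 1) b)))

/-- The contribution of the events at a queue to the drift of the joint tail function `F` of that
queue (first argument) and the queue of its partner. -/
noncomputable def tailDrift (lam : ℝ) (F : ℕ → ℕ → ℝ) (a b : ℕ) : ℝ :=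
  tailGain lam F a b - activeInd a * F a b

theorem tailGain_sub (lam : ℝ) (F G : ℕ → ℕ → ℝ) (a b : ℕ) :
    tailGain lam (fun i j => F i j - G i j) a b = tailGain lam F a b - tailGain lam G a b := by
  unfold tailGain; ring

theorem tailDrift_sub (lam : ℝ) (F G : ℕ → ℕ → ℝ) (a b : ℕ) :
    tailDrift lam (fun i j => F i j - G i j) a b = tailDrift lam F a b - tailDrift lam G a b := by
  unfold tailDrift; rw [tailGain_sub]; ring

theorem abs_tailGain_le {lam : ℝ} (hlam : 0 ≤ lam) {F : ℕ → ℕ → ℝ} {r S T : ℝ} (hr : 0 < r)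
    (hr₁ : r ≤ 1) (hS : ∀ i j, |F i j| ≤ S * r ^ (i + j)) {a b : ℕ}
    (hT : |F (a + 1) b| ≤ T * r ^ (a + 1 + b)) :
    |tailGain lam F a b| ≤ activeInd a * ((T * r + 2 * lam * (1 + r⁻¹) * S) * r ^ (a + b)) := by
  rw [tailGain, abs_mul, abs_of_nonneg (activeInd_nonneg a)]
  refine activeInd_mul_le_mul fun ha => ?_
  obtain ⟨c, rfl⟩ := Nat.exists_eq_succ_of_ne_zero ha
  have hS₀ : 0 ≤ S := by simpa using (abs_nonneg _).trans (hS 0 0)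
  have hle : ∀ i j k : ℕ, k ≤ i + j → |F i j| ≤ S * r ^ k := fun i j k hk =>
    (hS i j).trans (mul_le_mul_of_nonneg_left (pow_le_pow_of_le_one hr.le hr₁ hk) hS₀)
  have h₁ := hle c (max (c + 1) b) (c + b) (by omega)
  have h₂ := hle c (max c b) (c + b) (by omega)
  have h₃ := hle (c + 1) (max (c + 1) b) (c + 1 + b) (by omega)
  have h₄ := hle (c + 1) (max c b) (c + 1 + b) (by omega)
  rw [show r ^ (c + b) = r⁻¹ * r ^ (c + 1 + b) by
    rw [add_right_comm, pow_succ]; field_simp] at h₁ h₂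
  rw [show r ^ (c + 1 + 1 + b) = r * r ^ (c + 1 + b) by ring] at hT
  simp only [Nat.succ_eq_add_one, Nat.add_sub_cancel]
  set p := r ^ (c + 1 + b)
  have harrival : |F c (max (c + 1) b) + F c (max c b) - F (c + 1) (max (c + 1) b)
      - F (c + 1) (max c b)| ≤ 2 * (S * (r⁻¹ * p)) + 2 * (S * p) := by
    rw [abs_le] at *
    constructor <;> linarith
  refine (abs_add_le _ _).trans ?_
  rw [abs_mul, abs_of_nonneg hlam]
  linarith [mul_le_mul_of_nonneg_left harrival hlam]

end Drift

section MaximumPrinciple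

variable {n : ℕ}

/-- The multi-index `m` with the entries at `v` and `w` replaced by `i` and `j`. -/
def setPair (m : Fin n → ℕ) (v w : Fin n) (i j : ℕ) : Fin n → ℕ :=
  Function.update (Function.update m v i) w j

/-- The action of the generator on functions `D m M` of a multi-index and a matching, standing for
the measure of the states with matching `M` and queues at least `m`. -/
noncomputable def tailGenerator (lam κ : ℝ) (D : (Fin n → ℕ) → PerfectMatching n → ℝ)
    (m : Fin n → ℕ) (M : PerfectMatching n) : ℝ :=
  ∑ v, tailDrift lam (fun i j => D (setPair m v (M.1 v) i j) M) (m v) (m (M.1 v))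
    + κ * ((n : ℝ)⁻¹ * ∑ v, ∑ u, (D m (swapMembership v u M) - D m M))

/-- The number of nonzero entries of a multi-index. -/
noncomputable def active (m : Fin n → ℕ) : ℝ := ∑ v, activeInd (m v)

theorem active_nonneg (m : Fin n → ℕ) : 0 ≤ active m :=
  Finset.sum_nonneg fun v _ => activeInd_nonneg (m v)

theorem active_pos {m : Fin n → ℕ} (hm : m ≠ 0) : 0 < active m := by
  obtain ⟨v, hv⟩ := Function.ne_iff.1 hm
  exact Finset.sum_pos' (fun v _ => activeInd_nonneg (m v))
    ⟨v, Finset.mem_univ v, by rw [activeInd_of_ne_zero hv]; exact one_pos⟩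

instance (n : ℕ) : Finite (PerfectMatching n) :=
  inferInstanceAs (Finite {σ : Equiv.Perm (Fin n) // (∀ v, σ (σ v) = v) ∧ ∀ v, σ v ≠ v})

noncomputable instance (n : ℕ) : Fintype (PerfectMatching n) := Fintype.ofFinite _

theorem setPair_self (m : Fin n → ℕ) (v w : Fin n) : setPair m v w (m v) (m w) = m := by
  simp [setPair]

@[to_additive]
theorem prod_setPair {β : Type*} [CommMonoid β] (g : Fin n → ℕ → β) (m : Fin n → ℕ) {v w : Fin n}
    (h : w ≠ v) (i j : ℕ) : ∏ x, g x (setPair m v w i j x)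
      = g v i * g w j * ∏ x ∈ (Finset.univ.erase v).erase w, g x (m x) := by
  have hw : w ∈ Finset.univ.erase v := by simp [h]
  rw [← Finset.mul_prod_erase _ _ (Finset.mem_univ v), ← Finset.mul_prod_erase _ _ hw, ← mul_assoc]
  congr 1
  · simp [setPair, h.symm]
  · refine Finset.prod_congr rfl fun x hx => ?_
    simp only [Finset.mem_erase] at hx
    simp [setPair, hx.1, hx.2.1]

theorem tailGenerator_sub (lam κ : ℝ) (D E : (Fin n → ℕ) → PerfectMatching n → ℝ)
    (m : Fin n → ℕ) (M : PerfectMatching n) :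
    tailGenerator lam κ (fun m M => D m M - E m M) m M
      = tailGenerator lam κ D m M - tailGenerator lam κ E m M := by
  simp only [tailGenerator, tailDrift_sub, sub_sub_sub_comm (D m _), Finset.sum_sub_distrib]
  ring

theorem abs_sum_tailDrift_add_le {lam : ℝ} (hlam : 0 ≤ lam)
    {D : (Fin n → ℕ) → PerfectMatching n → ℝ} {r S : ℝ} (hr : 0 < r) (hr₁ : r ≤ 1)
    (hS : ∀ m M, |D m M| ≤ S * r ^ (∑ v, m v)) (m : Fin n → ℕ) (M : PerfectMatching n) :
    |∑ v, tailDrift lam (fun i j => D (setPair m v (M.1 v) i j) M) (m v) (m (M.1 v))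
        + active m * D m M|
      ≤ active m * ((r + 2 * lam * (1 + r⁻¹)) * S * r ^ (∑ v, m v)) := by
  simp only [tailDrift, setPair_self, Finset.sum_sub_distrib, ← Finset.sum_mul, active,
    sub_add_cancel]
  rw [Finset.sum_mul]
  refine (Finset.abs_sum_le_sum_abs _ _).trans (Finset.sum_le_sum fun v _ => ?_)
  set rest := ∑ x ∈ (Finset.univ.erase v).erase (M.1 v), m x
  have hrest : ∀ i j, |D (setPair m v (M.1 v) i j) M| ≤ S * r ^ rest * r ^ (i + j) := fun i j => by
    refine (hS _ _).trans_eq ?_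
    rw [sum_setPair (fun _ k => k) m (M.2.2 v), pow_add]; ring
  have hsum : ∑ x, m x = m v + m (M.1 v) + rest := by
    conv_lhs => rw [← setPair_self m v (M.1 v)]
    exact sum_setPair (fun _ k => k) m (M.2.2 v) _ _
  refine (abs_tailGain_le hlam hr hr₁ hrest (hrest _ _)).trans_eq ?_
  rw [hsum, pow_add]; ring

theorem mul_sum_swap_nonpos_of_forall_abs_le {κ : ℝ} (hκ : 0 ≤ κ) {f : PerfectMatching n → ℝ}
    {M : PerfectMatching n} (hM : ∀ M', |f M'| ≤ |f M|) :
    f M * (κ * ((n : ℝ)⁻¹ * ∑ v, ∑ u, (f (swapMembership v u M) - f M))) ≤ 0 := by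
  have hterm : ∀ M', f M * (f M' - f M) ≤ 0 := fun M' => by
    have h := mul_le_mul_of_nonneg_left (hM M') (abs_nonneg (f M))
    rw [← abs_mul, abs_mul_abs_self] at h
    linarith [le_abs_self (f M * f M')]
  have hsum : f M * ∑ v, ∑ u, (f (swapMembership v u M) - f M) ≤ 0 := by
    simp only [Finset.mul_sum]
    exact Finset.sum_nonpos fun v _ => Finset.sum_nonpos fun u _ => hterm _
  calc f M * (κ * ((n : ℝ)⁻¹ * ∑ v, ∑ u, (f (swapMembership v u M) - f M)))
      = κ * (n : ℝ)⁻¹ * (f M * ∑ v, ∑ u, (f (swapMembership v u M) - f M)) := by ring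
    _ ≤ 0 := mul_nonpos_of_nonneg_of_nonpos (by positivity) hsum

theorem mul_abs_le_abs_sub_of_mul_nonpos {k x t : ℝ} (h : x * t ≤ 0) :
    k * |x| ≤ |k * x - t| := by
  rcases le_or_gt x 0 with hx | hx
  · rcases hx.eq_or_lt with rfl | hx
    · simp
    · have ht : 0 ≤ t := nonneg_of_mul_nonpos_right h hx
      rw [abs_of_neg hx]
      linarith [neg_abs_le (k * x - t)]
  · have ht : t ≤ 0 := nonpos_of_mul_nonpos_right h hx
    rw [abs_of_pos hx]
    linarith [le_abs_self (k * x - t)]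

/- At a matching maximizing `|D m ·|` the swaps push `D m` towards `0`, whatever `κ` is, so the
service at the active vertices wins over the other terms. -/
theorem abs_le_of_abs_tailGenerator_le {lam κ : ℝ} (hlam : 0 ≤ lam) (hκ : 0 ≤ κ)
    {D : (Fin n → ℕ) → PerfectMatching n → ℝ} {r A ε : ℝ} (hr : 0 < r) (hr₁ : r ≤ 1)
    (hc : r + 2 * lam * (1 + r⁻¹) < 1) (hA : ∀ m M, |D m M| ≤ A * r ^ (∑ v, m v))
    (hzero : ∀ M, D 0 M = 0) (hε : 0 ≤ ε)
    (hD : ∀ m M, |tailGenerator lam κ D m M| ≤ active m * (ε * r ^ (∑ v, m v)))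
    (m : Fin n → ℕ) (M : PerfectMatching n) :
    |D m M| ≤ ε / (1 - (r + 2 * lam * (1 + r⁻¹))) * r ^ (∑ v, m v) := by
  refine abs_le_of_self_improving (ι := (Fin n → ℕ) × PerfectMatching n)
    (f := fun i => D i.1 i.2) (w := fun i => r ^ (∑ v, i.1 v)) (fun i => by positivity) hc
    (fun i => hA i.1 i.2) (fun S hS₀ hS => ?_) (m, M)
  rintro ⟨m, M⟩
  rcases eq_or_ne m 0 with rfl | hm
  · simp only [hzero, abs_zero]; positivity
  have : Nonempty (PerfectMatching n) := ⟨M⟩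
  obtain ⟨M₀, hM₀⟩ := Finite.exists_max fun M => |D m M|
  refine (hM₀ M).trans (le_of_mul_le_mul_left ?_ (active_pos hm))
  have hdrift := abs_sum_tailDrift_add_le hlam hr hr₁ (fun m M => hS (m, M)) m M₀
  have hswap := mul_sum_swap_nonpos_of_forall_abs_le hκ hM₀
  have hgen := hD m M₀
  rw [tailGenerator] at hgen
  refine (mul_abs_le_abs_sub_of_mul_nonpos hswap).trans ?_
  rw [← add_sub_add_left_eq_sub _ _ (∑ v, tailDrift lam
    (fun i j => D (setPair m v (M₀.1 v) i j) M₀) (m v) (m (M₀.1 v)))]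
  exact (abs_sub _ _).trans ((add_le_add hdrift hgen).trans_eq (by ring))

end MaximumPrinciple

section PairTail

/-- Candidates for the joint tail function of two queues: normalized, and at most
`δ * 4 ^ (-(a + b))` away from the origin. -/
structure IsSmallTail (δ : ℝ) (F : ℕ → ℕ → ℝ) : Prop where
  zero : F 0 0 = 1
  abs_le : ∀ a b, a ≠ 0 ∨ b ≠ 0 → |F a b| ≤ δ * (1 / 4) ^ (a + b)

/-- The failure of the queues of a matched pair with joint tail function `F` to be independent. -/
noncomputable def correlation (F : ℕ → ℕ → ℝ) (a b : ℕ) : ℝ := F a b - F a 0 * F b 0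

/-- The joint tail functions of the two queues of a matched pair in an infinite system: at
equilibrium, and with independent queues after each of the swaps, which break the pair at rate
`4 * κ`. -/
structure IsPairTail (lam κ : ℝ) (F : ℕ → ℕ → ℝ) : Prop extends IsSmallTail (1 / 100) F where
  comm : ∀ a b, F a b = F b a
  balance : ∀ a b, tailDrift lam F a b + tailDrift lam F b a = 4 * κ * correlation F a b

/-- The gain terms of the equation `IsPairTail.balance`. -/
noncomputable def pairGain (lam κ : ℝ) (F : ℕ → ℕ → ℝ) (a b : ℕ) : ℝ :=
  tailGain lam F a b + tailGain lam F b a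
    + 4 * κ * (activeInd a * activeInd b * (F a 0 * F b 0))

/-- The coefficient of `F a b` in the loss terms of the equation `IsPairTail.balance`. -/
noncomputable def pairRate (κ : ℝ) (a b : ℕ) : ℝ :=
  activeInd a + activeInd b + 4 * κ * (activeInd a * activeInd b)

/-- The map whose fixed points satisfy `IsPairTail.balance`. -/
noncomputable def pairMap (lam κ : ℝ) (F : ℕ → ℕ → ℝ) (a b : ℕ) : ℝ :=
  if a = 0 ∧ b = 0 then 1 else pairGain lam κ F a b / pairRate κ a b

variable {lam κ δ : ℝ} {F G : ℕ → ℕ → ℝ}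

theorem IsSmallTail.abs_le_pow (hδ : δ ≤ 1) (hF : IsSmallTail δ F) (a b : ℕ) :
    |F a b| ≤ (1 / 4) ^ (a + b) := by
  by_cases h : a ≠ 0 ∨ b ≠ 0
  · exact (hF.abs_le a b h).trans (mul_le_of_le_one_left (by positivity) hδ)
  · push Not at h
    simp [h.1, h.2, hF.zero]

theorem isClosed_isSmallTail : IsClosed {f : ℕ × ℕ → ℝ | IsSmallTail δ fun a b => f (a, b)} := by
  have h : {f : ℕ × ℕ → ℝ | IsSmallTail δ fun a b => f (a, b)} = {f | f (0, 0) = 1} ∩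
      ⋂ (a) (b) (_ : a ≠ 0 ∨ b ≠ 0), {f | |f (a, b)| ≤ δ * (1 / 4) ^ (a + b)} := by
    ext f
    simp only [Set.mem_inter_iff, Set.mem_ofPred_eq, Set.mem_iInter]
    exact ⟨fun hf => ⟨hf.zero, hf.abs_le⟩, fun hf => ⟨hf.1, hf.2⟩⟩
  rw [h]
  refine (isClosed_eq (continuous_apply _) continuous_const).inter ?_
  exact isClosed_iInter fun a => isClosed_iInter fun b => isClosed_iInter fun _ =>
    isClosed_le (continuous_apply _).abs continuous_const

theorem isSmallTail_single (hδ : 0 ≤ δ) :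
    IsSmallTail δ fun a b => if a = 0 ∧ b = 0 then 1 else 0 where
  zero := by simp
  abs_le a b h := by
    rw [if_neg (by tauto), abs_zero]
    positivity

theorem pairRate_pos (hκ : 0 ≤ κ) {a b : ℕ} (h : ¬(a = 0 ∧ b = 0)) : 0 < pairRate κ a b := by
  have hswap := mul_nonneg (mul_nonneg zero_le_four hκ)
    (mul_nonneg (activeInd_nonneg a) (activeInd_nonneg b))
  unfold pairRate
  rcases not_and_or.1 h with ha | hb
  · linarith [activeInd_of_ne_zero ha, activeInd_nonneg b]
  · linarith [activeInd_of_ne_zero hb, activeInd_nonneg a]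

theorem IsSmallTail.abs_tailGain_le (hlam : 0 ≤ lam) (hlam' : lam ≤ 1 / 2000)
    (hF : IsSmallTail (1 / 100) F) (a b : ℕ) :
    |tailGain lam F a b| ≤ activeInd a * (3 / 400 * (1 / 4) ^ (a + b)) := by
  have h := Supermarket.abs_tailGain_le hlam (r := 1 / 4) (S := 1) (by norm_num) (by norm_num)
    (by simpa using hF.abs_le_pow (by norm_num)) (hF.abs_le (a + 1) b (by simp))
  refine h.trans (mul_le_mul_of_nonneg_left ?_ (activeInd_nonneg a))
  gcongr
  norm_num
  linarith

theorem abs_tailGain_sub_le (hlam : 0 ≤ lam) (hlam' : lam ≤ 1 / 2000) {d : ℝ}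
    (hd : ∀ a b, |F a b - G a b| ≤ d * (1 / 4) ^ (a + b)) (a b : ℕ) :
    |tailGain lam F a b - tailGain lam G a b|
      ≤ activeInd a * (1 / 2 * d * (1 / 4) ^ (a + b)) := by
  have hd₀ : 0 ≤ d := by simpa using (abs_nonneg _).trans (hd 0 0)
  rw [← tailGain_sub]
  refine (Supermarket.abs_tailGain_le hlam (by norm_num) (by norm_num) hd (hd _ _)).trans ?_
  refine mul_le_mul_of_nonneg_left ?_ (activeInd_nonneg a)
  gcongr
  have : lam * d ≤ 1 / 2000 * d := by gcongr
  norm_num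
  linarith

theorem abs_mul_sub_mul_le {x y x' y' s t d : ℝ} (hx : |x| ≤ s) (hy' : |y'| ≤ t)
    (hxx' : |x - x'| ≤ d * s) (hyy' : |y - y'| ≤ d * t) :
    |x * y - x' * y'| ≤ 2 * d * (s * t) := by
  have hs := (abs_nonneg _).trans hx
  rw [show x * y - x' * y' = x * (y - y') + (x - x') * y' by ring]
  refine (abs_add_le _ _).trans ?_
  rw [abs_mul, abs_mul]
  linarith [mul_le_mul hx hyy' (abs_nonneg _) hs,
    mul_le_mul hxx' hy' (abs_nonneg _) ((abs_nonneg _).trans hxx')]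

theorem abs_pair_exchange_le (hκ : 0 ≤ κ) {a b : ℕ} {x p : ℝ} (h : a ≠ 0 → b ≠ 0 → |x| ≤ p) :
    |4 * κ * (activeInd a * activeInd b * x)| ≤ 4 * κ * (activeInd a * activeInd b * p) := by
  rw [abs_mul, abs_of_nonneg (mul_nonneg zero_le_four hκ), abs_mul,
    abs_of_nonneg (mul_nonneg (activeInd_nonneg a) (activeInd_nonneg b)), mul_assoc (activeInd a),
    mul_assoc (activeInd a)]
  refine mul_le_mul_of_nonneg_left ?_ (mul_nonneg zero_le_four hκ)
  exact activeInd_mul_le_mul fun ha => activeInd_mul_le_mul (h ha)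

theorem IsSmallTail.abs_pairGain_le (hlam : 0 ≤ lam) (hlam' : lam ≤ 1 / 2000) (hκ : 0 ≤ κ)
    (hF : IsSmallTail (1 / 100) F) (a b : ℕ) :
    |pairGain lam κ F a b| ≤ 1 / 100 * (1 / 4) ^ (a + b) * pairRate κ a b := by
  have hab := hF.abs_tailGain_le hlam hlam' a b
  have hba := hF.abs_tailGain_le hlam hlam' b a
  have hexchange := abs_pair_exchange_le hκ (a := a) (b := b) (x := F a 0 * F b 0)
      (p := 1 / 100 * (1 / 4) ^ (a + b)) fun ha _ => by
    have ha' := hF.abs_le a 0 (.inl ha)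
    have hb' := hF.abs_le_pow (by norm_num) b 0
    rw [abs_mul, pow_add, ← mul_assoc]
    exact mul_le_mul ha' hb' (abs_nonneg _) (by positivity)
  rw [add_comm b a] at hba
  have hp : (0 : ℝ) ≤ (1 / 4) ^ (a + b) := by positivity
  refine (abs_add_three _ _ _).trans ?_
  rw [pairRate]
  linarith [mul_nonneg (activeInd_nonneg a) hp, mul_nonneg (activeInd_nonneg b) hp]

theorem abs_pairGain_sub_le (hlam : 0 ≤ lam) (hlam' : lam ≤ 1 / 2000) (hκ : 0 ≤ κ)
    (hF : IsSmallTail (1 / 100) F) (hG : IsSmallTail (1 / 100) G) {d : ℝ}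
    (hd : ∀ a b, |F a b - G a b| ≤ d * (1 / 4) ^ (a + b)) (a b : ℕ) :
    |pairGain lam κ F a b - pairGain lam κ G a b|
      ≤ 1 / 2 * d * (1 / 4) ^ (a + b) * pairRate κ a b := by
  have hd₀ : 0 ≤ d := by simpa using (abs_nonneg _).trans (hd 0 0)
  have hab := abs_tailGain_sub_le hlam hlam' hd a b
  have hba := abs_tailGain_sub_le hlam hlam' hd b a
  have hexchange := abs_pair_exchange_le hκ (a := a) (b := b)
      (x := F a 0 * F b 0 - G a 0 * G b 0) (p := 1 / 2 * d * (1 / 4) ^ (a + b)) fun ha hb => by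
    have h := abs_mul_sub_mul_le (s := 1 / 100 * (1 / 4) ^ a) (t := 1 / 100 * (1 / 4) ^ b)
      (d := 100 * d) (hF.abs_le a 0 (.inl ha)) (hG.abs_le b 0 (.inl hb))
      ((hd a 0).trans_eq (by rw [add_zero]; ring)) ((hd b 0).trans_eq (by rw [add_zero]; ring))
    have : 0 ≤ d * ((1 / 4) ^ a * (1 / 4) ^ b) := by positivity
    rw [pow_add]
    linarith
  rw [add_comm b a] at hba
  rw [pairGain, pairGain, add_sub_add_comm, add_sub_add_comm, ← mul_sub, ← mul_sub]
  refine (abs_add_three _ _ _).trans ((add_le_add_three hab hba hexchange).trans_eq ?_)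
  rw [pairRate]; ring

theorem isSmallTail_pairMap (hlam : 0 ≤ lam) (hlam' : lam ≤ 1 / 2000) (hκ : 0 ≤ κ)
    (hF : IsSmallTail (1 / 100) F) : IsSmallTail (1 / 100) (pairMap lam κ F) where
  zero := by simp [pairMap]
  abs_le a b hab := by
    have hne : ¬(a = 0 ∧ b = 0) := by tauto
    have hpos := pairRate_pos hκ hne
    rw [pairMap, if_neg hne, abs_div, abs_of_pos hpos, div_le_iff₀ hpos]
    exact hF.abs_pairGain_le hlam hlam' hκ a b

theorem abs_pairMap_sub_le (hlam : 0 ≤ lam) (hlam' : lam ≤ 1 / 2000) (hκ : 0 ≤ κ)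
    (hF : IsSmallTail (1 / 100) F) (hG : IsSmallTail (1 / 100) G) {d : ℝ}
    (hd : ∀ a b, |F a b - G a b| ≤ d * (1 / 4) ^ (a + b)) (a b : ℕ) :
    |pairMap lam κ F a b - pairMap lam κ G a b| ≤ 1 / 2 * d * (1 / 4) ^ (a + b) := by
  have hd₀ : 0 ≤ d := by simpa using (abs_nonneg _).trans (hd 0 0)
  unfold pairMap
  split_ifs with h
  · simp only [sub_self, abs_zero]; positivity
  · have hpos := pairRate_pos hκ h
    rw [← sub_div, abs_div, abs_of_pos hpos, div_le_iff₀ hpos]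
    exact abs_pairGain_sub_le hlam hlam' hκ hF hG hd a b

theorem pairMap_comm (lam κ : ℝ) (F : ℕ → ℕ → ℝ) (a b : ℕ) :
    pairMap lam κ F a b = pairMap lam κ F b a := by
  simp only [pairMap, pairGain, pairRate, and_comm, mul_comm (F a 0), mul_comm (activeInd a),
    add_comm (tailGain lam F a b), add_comm (activeInd a)]

theorem correlation_eq_activeInd_mul (h₀ : F 0 0 = 1) (hF : ∀ a b, F a b = F b a) (a b : ℕ) :
    correlation F a b = activeInd a * activeInd b * correlation F a b := by
  rcases eq_or_ne a 0 with rfl | ha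
  · simp [correlation, h₀, hF 0 b]
  rcases eq_or_ne b 0 with rfl | hb
  · simp [correlation, h₀]
  rw [activeInd_of_ne_zero ha, activeInd_of_ne_zero hb, one_mul, one_mul]

theorem IsSmallTail.isPairTail_of_pairMap_eq (hκ : 0 ≤ κ) (hF : IsSmallTail (1 / 100) F)
    (hfix : pairMap lam κ F = F) : IsPairTail lam κ F := by
  have hcomm : ∀ a b, F a b = F b a := fun a b => by rw [← hfix, pairMap_comm]
  refine ⟨hF, hcomm, fun a b => ?_⟩
  by_cases h : a = 0 ∧ b = 0
  · simp [h.1, h.2, tailDrift, tailGain, correlation, hF.zero]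
  have hab := congrFun (congrFun hfix a) b
  rw [pairMap, if_neg h, div_eq_iff (pairRate_pos hκ h).ne', pairGain, pairRate] at hab
  rw [correlation_eq_activeInd_mul hF.zero hcomm, tailDrift, tailDrift, hcomm b a, correlation]
  linear_combination hab

theorem exists_isPairTail (hlam : 0 ≤ lam) (hlam' : lam ≤ 1 / 2000) (hκ : 0 ≤ κ) :
    ∃ F, IsPairTail lam κ F := by
  have hstart := isSmallTail_single (δ := 1 / 100) (by norm_num)
  have hdist (i : ℕ × ℕ) : |(if i.1 = 0 ∧ i.2 = 0 then 1 else 0) - pairMap lam κ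
      (fun a b => if a = 0 ∧ b = 0 then 1 else 0) i.1 i.2| ≤ 2 * (1 / 4) ^ (i.1 + i.2) := by
    have h₀ := hstart.abs_le_pow (by norm_num) i.1 i.2
    have h₁ := (isSmallTail_pairMap hlam hlam' hκ hstart).abs_le_pow (by norm_num) i.1 i.2
    exact (abs_sub _ _).trans ((add_le_add h₀ h₁).trans_eq (by ring))
  obtain ⟨f, hf, hfix⟩ := exists_fixedPoint_of_weighted_contraction (ι := ℕ × ℕ)
    (w := fun i => (1 / 4) ^ (i.1 + i.2)) (K := 1 / 2)
    (T := fun f i => pairMap lam κ (fun a b => f (a, b)) i.1 i.2)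
    isClosed_isSmallTail (fun f hf => isSmallTail_pairMap hlam hlam' hκ hf)
    (by norm_num) (by norm_num)
    (fun f hf g hg S hS i => abs_pairMap_sub_le hlam hlam' hκ hf hg (fun a b => hS (a, b)) i.1 i.2)
    (f₀ := fun i => if i.1 = 0 ∧ i.2 = 0 then 1 else 0) hstart hdist
  exact ⟨_, hf.isPairTail_of_pairMap_eq hκ
    (funext fun a => funext fun b => congrFun hfix (a, b))⟩

theorem IsPairTail.abs_mul_correlation_le (hlam : 0 ≤ lam) (hlam' : lam ≤ 1 / 2000)
    (hF : IsPairTail lam κ F) (a b : ℕ) :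
    |κ * correlation F a b| ≤ activeInd a * activeInd b * (1 / 100 * (1 / 4) ^ (a + b)) := by
  rw [correlation_eq_activeInd_mul hF.zero hF.comm, mul_left_comm, abs_mul,
    abs_of_nonneg (mul_nonneg (activeInd_nonneg a) (activeInd_nonneg b)), mul_assoc,
    mul_assoc (activeInd a)]
  refine activeInd_mul_le_mul fun ha => activeInd_mul_le_mul fun hb => ?_
  have hab := hF.abs_tailGain_le hlam hlam' a b
  have hba := hF.abs_tailGain_le hlam hlam' b a
  have htail := hF.abs_le a b (.inl ha)
  have hbalance := hF.balance a b
  rw [tailDrift, tailDrift, activeInd_of_ne_zero ha, activeInd_of_ne_zero hb, hF.comm b a]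
    at hbalance
  rw [activeInd_of_ne_zero ha, one_mul] at hab
  rw [activeInd_of_ne_zero hb, one_mul, add_comm b a] at hba
  have hp : (0 : ℝ) ≤ (1 / 4) ^ (a + b) := by positivity
  rw [abs_le] at *
  constructor <;> linarith

theorem IsPairTail.abs_correlation_le (hF : IsPairTail lam κ F) (a b : ℕ) :
    |correlation F a b| ≤ activeInd a * activeInd b * (1 / 4) ^ (a + b) := by
  rw [correlation_eq_activeInd_mul hF.zero hF.comm, abs_mul,
    abs_of_nonneg (mul_nonneg (activeInd_nonneg a) (activeInd_nonneg b)), mul_assoc,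
    mul_assoc (activeInd a)]
  refine activeInd_mul_le_mul fun ha => activeInd_mul_le_mul fun hb => ?_
  have ha' := hF.abs_le_pow (by norm_num) a 0
  have hb' := hF.abs_le b 0 (.inl hb)
  have hab := hF.abs_le a b (.inl ha)
  have hmul := mul_le_mul ha' hb' (abs_nonneg _) (by positivity)
  rw [add_zero, add_zero, mul_left_comm, ← pow_add, ← abs_mul] at hmul
  have hp : (0 : ℝ) ≤ (1 / 4) ^ (a + b) := by positivity
  exact (abs_sub _ _).trans (by linarith)

end PairTail
section JointTail

/-- The indicator of `a ≤ q`, as a real number. -/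
noncomputable def geInd (a q : ℕ) : ℝ := if a ≤ q then 1 else 0

/-- Twice the probability that a task offered to queues of lengths `x`, `y` joins the first. -/
noncomputable def preference (x y : ℕ) : ℝ := if x < y then 2 else if x = y then 1 else 0

theorem geInd_of_le {a q : ℕ} (h : a ≤ q) : geInd a q = 1 := if_pos h

theorem geInd_of_lt {a q : ℕ} (h : q < a) : geInd a q = 0 := if_neg (not_le.2 h)

theorem geInd_max (a b q : ℕ) : geInd (max a b) q = geInd a q * geInd b q := by
  simp only [geInd, max_le_iff, ite_and, ite_mul, one_mul, zero_mul]

theorem geInd_nonneg (a q : ℕ) : 0 ≤ geInd a q := by unfold geInd; split_ifs <;> simp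

theorem geInd_le_one (a q : ℕ) : geInd a q ≤ 1 := by unfold geInd; split_ifs <;> simp

/- A task joining the first queue makes it exceed `c` only if `x = c`, and then the tie-breaking
rule becomes a condition on `y` alone. -/
theorem preference_mul_geInd_sub (c x y : ℕ) :
    preference x y * (geInd c x - geInd (c + 1) x)
      = (geInd c x - geInd (c + 1) x) * (geInd (c + 1) y + geInd c y) := by
  rcases lt_trichotomy x c with h | rfl | h
  · simp only [geInd_of_lt h, geInd_of_lt (h.trans (Nat.lt_succ_self c)), sub_self, mul_zero,
      zero_mul]
  · rw [mul_comm]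
    congr 1
    rcases lt_trichotomy x y with h | rfl | h
    · rw [preference, if_pos h, geInd_of_le h.le, geInd_of_le (Nat.succ_le_of_lt h)]; norm_num
    · simp [preference, geInd]
    · rw [preference, if_neg h.not_gt, if_neg h.ne', geInd_of_lt h,
        geInd_of_lt (h.trans (Nat.lt_succ_self x)), add_zero]
  · simp only [geInd_of_le h.le, geInd_of_le (Nat.succ_le_of_lt h), sub_self, mul_zero, zero_mul]

theorem tailDrift_geInd (lam : ℝ) (a b x y : ℕ) :
    lam * (preference x y * ((geInd a (x + 1) - geInd a x) * geInd b y))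
      + (geInd a (x - 1) - geInd a x) * geInd b y
      = tailDrift lam (fun i j => geInd i x * geInd j y) a b := by
  rcases a with _ | c
  · simp [tailDrift, tailGain, geInd]
  have harrival : geInd (c + 1) (x + 1) = geInd c x := by simp [geInd]
  have hservice : geInd (c + 1) (x - 1) = geInd (c + 1 + 1) x := by
    simp only [geInd, show c + 1 ≤ x - 1 ↔ c + 1 + 1 ≤ x by omega]
  simp only [tailDrift, tailGain, activeInd_of_ne_zero (Nat.succ_ne_zero c),
    Nat.add_sub_cancel, geInd_max, harrival, hservice]
  linear_combination lam * geInd b y * preference_mul_geInd_sub c x y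

theorem mem_shortest_iff {n : ℕ} (s : State n) (v u : Fin n) :
    u ∈ shortest s v
      ↔ u = v ∧ s.1 v ≤ s.1 (s.2.1 v) ∨ u = s.2.1 v ∧ s.1 (s.2.1 v) ≤ s.1 v := by
  simp only [shortest, nbhd, Finset.mem_filter, Finset.mem_insert, Finset.mem_singleton,
    forall_eq_or_imp, forall_eq]
  constructor
  · rintro ⟨rfl | rfl, h₁, h₂⟩
    · exact .inl ⟨rfl, h₂⟩
    · exact .inr ⟨rfl, h₁⟩
  · rintro (⟨rfl, h⟩ | ⟨rfl, h⟩)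
    · exact ⟨.inl rfl, le_rfl, h⟩
    · exact ⟨.inr rfl, h, le_rfl⟩

theorem shortest_average {n : ℕ} (s : State n) (v : Fin n) (f : Fin n → ℝ) :
    ((shortest s v).card : ℝ)⁻¹ * ∑ u ∈ shortest s v, f u
      = 2⁻¹ * (preference (s.1 v) (s.1 (s.2.1 v)) * f v
        + preference (s.1 (s.2.1 v)) (s.1 v) * f (s.2.1 v)) := by
  rcases lt_trichotomy (s.1 v) (s.1 (s.2.1 v)) with h | h | h
  · have hshortest : shortest s v = {v} := by
      ext u; simp [mem_shortest_iff, h.le, h.not_ge]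
    simp [hshortest, preference, h, h.not_gt, h.ne']
  · have hshortest : shortest s v = {v, s.2.1 v} := by
      ext u; simp [mem_shortest_iff, h]
    rw [hshortest, Finset.card_pair (s.2.2.2 v).symm, Finset.sum_pair (s.2.2.2 v).symm]
    simp [preference, h]
  · have hshortest : shortest s v = {s.2.1 v} := by
      ext u; simp [mem_shortest_iff, h.le, h.not_ge]
    simp [hshortest, preference, h, h.not_gt, h.ne']

theorem sum_shortest_average {n : ℕ} (s : State n) (f : Fin n → ℝ) :
    ∑ v, ((shortest s v).card : ℝ)⁻¹ * ∑ u ∈ shortest s v, f u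
      = ∑ v, preference (s.1 v) (s.1 (s.2.1 v)) * f v := by
  have hpartner : ∑ v, preference (s.1 (s.2.1 v)) (s.1 v) * f (s.2.1 v)
      = ∑ v, preference (s.1 v) (s.1 (s.2.1 v)) * f v := by
    rw [← Equiv.sum_comp s.2.1 fun v => preference (s.1 v) (s.1 (s.2.1 v)) * f v]
    simp only [s.2.2.1]
  simp only [shortest_average]
  rw [← Finset.mul_sum, Finset.sum_add_distrib, hpartner]
  ring

variable {n : ℕ}

/-- The indicator that all queues are at least as long as `m` prescribes. -/
noncomputable def geIndProd (m q : Fin n → ℕ) : ℝ := ∏ v, geInd (m v) (q v)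

open Classical in
/-- The indicator that all queues are at least as long as `m` prescribes and the matching is `M`. -/
noncomputable def tailInd (m : Fin n → ℕ) (M : PerfectMatching n) (s : State n) : ℝ :=
  if s.2 = M then geIndProd m s.1 else 0

theorem geIndProd_setPair_left (m q : Fin n → ℕ) {v w : Fin n} (h : w ≠ v) (i j : ℕ) :
    geIndProd (setPair m v w i j) q = geInd i (q v) * geInd j (q w)
      * ∏ u ∈ (Finset.univ.erase v).erase w, geInd (m u) (q u) :=
  prod_setPair (fun u k => geInd k (q u)) m h i j

theorem geIndProd_update_right (m q : Fin n → ℕ) {v w : Fin n} (h : w ≠ v) (x : ℕ) :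
    geIndProd m (Function.update q v x) = geInd (m v) x * geInd (m w) (q w)
      * ∏ u ∈ (Finset.univ.erase v).erase w, geInd (m u) (q u) := by
  rw [← prod_setPair (fun u k => geInd (m u) k) q h, setPair, ← Function.update_of_ne h x q,
    Function.update_eq_self]
  rfl

theorem tailDrift_mul_right (lam : ℝ) (F : ℕ → ℕ → ℝ) (c : ℝ) (a b : ℕ) :
    tailDrift lam (fun i j => F i j * c) a b = tailDrift lam F a b * c := by
  unfold tailDrift tailGain; ring

theorem swapMembership_swapMembership (u v : Fin n) (M : PerfectMatching n) :
    swapMembership u v (swapMembership u v M) = M := by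
  apply Subtype.ext
  simp [swapMembership, mul_assoc]

theorem tailInd_swapMembership (m : Fin n → ℕ) (M : PerfectMatching n) (s : State n)
    (u v : Fin n) :
    tailInd m M (s.1, swapMembership u v s.2) = tailInd m (swapMembership u v M) s := by
  have hswap : swapMembership u v s.2 = M ↔ s.2 = swapMembership u v M :=
    ⟨fun h => by rw [← h, swapMembership_swapMembership],
      fun h => by rw [h, swapMembership_swapMembership]⟩
  by_cases h : s.2 = swapMembership u v M
  · rw [tailInd, tailInd, if_pos (hswap.2 h), if_pos h]
  · rw [tailInd, tailInd, if_neg fun h' => h (hswap.1 h'), if_neg h]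

theorem generator_tailInd (lam κ : ℝ) (m : Fin n → ℕ) (M : PerfectMatching n) (s : State n) :
    generator lam κ (tailInd m M) s = tailGenerator lam κ (fun m' M' => tailInd m' M' s) m M := by
  simp only [generator, tailGenerator, Finset.sum_add_distrib, ← Finset.mul_sum,
    tailInd_swapMembership, sum_shortest_average]
  congr 1
  rw [Finset.mul_sum, ← Finset.sum_add_distrib]
  refine Finset.sum_congr rfl fun v _ => ?_
  obtain ⟨q, M'⟩ := s
  by_cases hM : M' = M
  · subst hM
    have hne := M'.2.2 v
    have hself := geIndProd_update_right m q hne (q v)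
    rw [Function.update_eq_self] at hself
    simp only [tailInd, addTask, serve, if_true, geIndProd_update_right m q hne, hself,
      geIndProd_setPair_left m q hne, tailDrift_mul_right, ← tailDrift_geInd]
    ring
  · simp [tailInd, addTask, serve, hM, tailDrift, tailGain]

theorem tailInd_nonneg (m : Fin n → ℕ) (M : PerfectMatching n) (s : State n) :
    0 ≤ tailInd m M s := by
  unfold tailInd
  split_ifs
  exacts [Finset.prod_nonneg fun _ _ => geInd_nonneg _ _, le_rfl]

theorem abs_tailInd_le_one (m : Fin n → ℕ) (M : PerfectMatching n) (s : State n) :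
    |tailInd m M s| ≤ 1 := by
  rw [abs_of_nonneg (tailInd_nonneg m M s), tailInd]
  split_ifs
  exacts [Finset.prod_le_one (fun _ _ => geInd_nonneg _ _) fun _ _ => geInd_le_one _ _, zero_le_one]

/-- The joint tail function of a distribution on the states. -/
noncomputable def jointTail (μ : PMF (State n)) (m : Fin n → ℕ) (M : PerfectMatching n) : ℝ :=
  ∑' s, (μ s).toReal * tailInd m M s

theorem hasSum_jointTail (μ : PMF (State n)) (m : Fin n → ℕ) (M : PerfectMatching n) :
    HasSum (fun s => (μ s).toReal * tailInd m M s) (jointTail μ m M) :=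
  (summable_toReal_mul μ (abs_tailInd_le_one m M)).hasSum

theorem jointTail_nonneg (μ : PMF (State n)) (m : Fin n → ℕ) (M : PerfectMatching n) :
    0 ≤ jointTail μ m M :=
  tsum_nonneg fun _ => mul_nonneg ENNReal.toReal_nonneg (tailInd_nonneg _ _ _)

theorem hasSum_tailDrift {α : Type*} (lam : ℝ) {p : α → ℝ} {f : α → ℕ → ℕ → ℝ} {F : ℕ → ℕ → ℝ}
    (h : ∀ i j, HasSum (fun x => p x * f x i j) (F i j)) (a b : ℕ) :
    HasSum (fun x => p x * tailDrift lam (f x) a b) (tailDrift lam F a b) := by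
  refine (((h (a + 1) b).add (((((h (a - 1) (max a b)).add (h (a - 1) (max (a - 1) b))).sub
    (h a (max a b))).sub (h a (max (a - 1) b))).mul_left lam)).mul_left (activeInd a)).sub
    ((h a b).mul_left (activeInd a)) |>.congr_fun fun x => ?_
  unfold tailDrift tailGain; ring

theorem hasSum_tailGenerator {α : Type*} (lam κ : ℝ) {p : α → ℝ}
    {D : α → (Fin n → ℕ) → PerfectMatching n → ℝ} {E : (Fin n → ℕ) → PerfectMatching n → ℝ}
    (h : ∀ m M, HasSum (fun x => p x * D x m M) (E m M)) (m : Fin n → ℕ) (M : PerfectMatching n) :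
    HasSum (fun x => p x * tailGenerator lam κ (D x) m M) (tailGenerator lam κ E m M) := by
  have hdrift := hasSum_sum fun v (_ : v ∈ Finset.univ) => hasSum_tailDrift lam
    (fun i j => h (setPair m v (M.1 v) i j) M) (m v) (m (M.1 v))
  have hswap := hasSum_sum fun v (_ : v ∈ Finset.univ) => hasSum_sum fun u (_ : u ∈ Finset.univ) =>
    (h m (swapMembership v u M)).sub (h m M)
  refine (hdrift.add ((hswap.mul_left (n : ℝ)⁻¹).mul_left κ)).congr_fun fun x => ?_
  simp only [tailGenerator, ← mul_sub, ← Finset.mul_sum]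
  ring

theorem IsStationary.tailGenerator_jointTail {lam κ : ℝ} {μ : PMF (State n)}
    (hμ : IsStationary lam κ μ) (m : Fin n → ℕ) (M : PerfectMatching n) :
    tailGenerator lam κ (jointTail μ) m M = 0 := by
  rw [← (hasSum_tailGenerator lam κ (hasSum_jointTail μ) m M).tsum_eq]
  simp only [← generator_tailInd]
  exact hμ (tailInd m M) ⟨1, abs_tailInd_le_one m M⟩

end JointTail

section Stationary

variable {n : ℕ} {lam κ : ℝ}

/-- The generator as a linear map. -/
noncomputable def generatorHom (lam κ : ℝ) (n : ℕ) : (State n → ℝ) →ₗ[ℝ] (State n → ℝ) where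
  toFun := generator lam κ
  map_add' f g := by
    ext s
    simp only [generator, Pi.add_apply, add_sub_add_comm, ← Finset.sum_add_distrib]
    refine Finset.sum_congr rfl fun v _ => ?_
    simp only [Finset.sum_add_distrib]
    ring
  map_smul' c f := by
    ext s
    simp only [generator, Pi.smul_apply, smul_eq_mul, ← mul_sub, ← Finset.mul_sum, RingHom.id_apply]
    rw [Finset.mul_sum]
    exact Finset.sum_congr rfl fun v _ => by ring

theorem shortest_nonempty (s : State n) (v : Fin n) : (shortest s v).Nonempty := by
  rcases le_total (s.1 v) (s.1 (s.2.1 v)) with h | h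
  exacts [⟨v, (mem_shortest_iff s v v).2 (.inl ⟨rfl, h⟩)⟩,
    ⟨s.2.1 v, (mem_shortest_iff s v _).2 (.inr ⟨rfl, h⟩)⟩]

theorem card_inv_mul_sum_sub {α : Type*} {S : Finset α} (hS : S.Nonempty) (f : α → ℝ) (c : ℝ) :
    (S.card : ℝ)⁻¹ * ∑ x ∈ S, (f x - c) = (S.card : ℝ)⁻¹ * ∑ x ∈ S, f x - c := by
  rw [Finset.sum_sub_distrib, Finset.sum_const, nsmul_eq_mul, mul_sub,
    inv_mul_cancel_left₀ (Nat.cast_ne_zero.2 hS.card_pos.ne')]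

theorem generator_add_rate_mul (lam κ : ℝ) (f : State n → ℝ) (s : State n) :
    generator lam κ f s + n * (lam + 1 + κ) * f s
      = ∑ v, (lam * (((shortest s v).card : ℝ)⁻¹ * ∑ u ∈ shortest s v, f (addTask s u))
        + f (serve s v) + κ * ((n : ℝ)⁻¹ * ∑ u, f (s.1, swapMembership v u s.2))) := by
  have hrate : n * (lam + 1 + κ) * f s = ∑ _v : Fin n, (lam + 1 + κ) * f s := by simp [mul_assoc]
  rw [hrate, generator, ← Finset.sum_add_distrib]
  refine Finset.sum_congr rfl fun v _ => ?_
  have hswap := card_inv_mul_sum_sub ⟨v, Finset.mem_univ v⟩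
    (fun u => f (s.1, swapMembership v u s.2)) (f s)
  rw [Finset.card_univ, Fintype.card_fin] at hswap
  rw [card_inv_mul_sum_sub (shortest_nonempty s v), hswap]
  ring

theorem isJumpGenerator_generatorHom (hlam : 0 ≤ lam) (hκ : 0 ≤ κ) (n : ℕ) :
    IsJumpGenerator (n * (lam + 1 + κ)) (generatorHom lam κ n) where
  map_one := by ext s; simp [generatorHom, generator]
  monotone f g hfg s := by
    change generator lam κ f s + n * (lam + 1 + κ) * f s
      ≤ generator lam κ g s + n * (lam + 1 + κ) * g s
    rw [generator_add_rate_mul, generator_add_rate_mul]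
    gcongr <;> exact hfg _

/-- A Lyapunov function of the model. -/
noncomputable def lyapunov (s : State n) : ℝ := ∏ v, (8 * (n : ℝ) + 2 ^ s.1 v)

/-- The relative increase of the Lyapunov function when a task joins a queue of length `q`. -/
noncomputable def relIncrease (n q : ℕ) : ℝ := 2 ^ q / (8 * (n : ℝ) + 2 ^ q)

theorem two_pow_sum_le_lyapunov (s : State n) : 2 ^ (∑ v, s.1 v) ≤ lyapunov s := by
  rw [lyapunov, ← Finset.prod_pow_eq_pow_sum]
  exact Finset.prod_le_prod (fun _ _ => by positivity) fun _ _ => by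
    linarith [(Nat.cast_nonneg n : (0 : ℝ) ≤ n)]

theorem lyapunov_pos (s : State n) : 0 < lyapunov s :=
  lt_of_lt_of_le (by positivity) (two_pow_sum_le_lyapunov s)

theorem finite_lyapunov_le (n : ℕ) (c : ℝ) : {s : State n | lyapunov s ≤ c}.Finite := by
  refine ((Set.finite_Iic (fun _ : Fin n => ⌊c⌋₊)).prod Set.finite_univ).subset fun s hs => ?_
  refine ⟨fun v => Nat.le_floor ?_, trivial⟩
  refine le_trans ?_ ((two_pow_sum_le_lyapunov s).trans hs)
  have hle : s.1 v ≤ ∑ v, s.1 v :=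
    Finset.single_le_sum (fun _ _ => Nat.zero_le _) (Finset.mem_univ v)
  exact_mod_cast (hle.trans_lt Nat.lt_two_pow_self).le

theorem relIncrease_nonneg (n q : ℕ) : 0 ≤ relIncrease n q := by unfold relIncrease; positivity

theorem relIncrease_mono (n : ℕ) : Monotone (relIncrease n) := by
  intro a b hab
  have hpow : (2 : ℝ) ^ a ≤ 2 ^ b := pow_le_pow_right₀ one_le_two hab
  rw [relIncrease, relIncrease, div_le_div_iff₀ (by positivity) (by positivity)]
  linarith [mul_le_mul_of_nonneg_left hpow (by positivity : 0 ≤ 8 * (n : ℝ)),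
    mul_comm ((2 : ℝ) ^ a) (2 ^ b)]

theorem mul_relIncrease_zero_le (n : ℕ) : n * relIncrease n 0 ≤ 1 / 8 := by
  rw [relIncrease, pow_zero, mul_one_div, div_le_div_iff₀ (by positivity) (by norm_num)]
  linarith

theorem lyapunov_update (s : State n) (v : Fin n) (x : ℕ) :
    lyapunov (Function.update s.1 v x, s.2) - lyapunov s
      = lyapunov s * ((2 ^ x - 2 ^ s.1 v) / (8 * (n : ℝ) + 2 ^ s.1 v)) := by
  have hpos : (8 * (n : ℝ) + 2 ^ s.1 v) ≠ 0 := by positivity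
  have hrest : ∏ w ∈ Finset.univ.erase v, (8 * (n : ℝ) + 2 ^ Function.update s.1 v x w)
      = ∏ w ∈ Finset.univ.erase v, (8 * (n : ℝ) + 2 ^ s.1 w) :=
    Finset.prod_congr rfl fun w hw => by rw [Function.update_of_ne (Finset.ne_of_mem_erase hw)]
  rw [lyapunov, lyapunov, ← Finset.mul_prod_erase _ _ (Finset.mem_univ v),
    ← Finset.mul_prod_erase _ (fun w => 8 * (n : ℝ) + 2 ^ s.1 w) (Finset.mem_univ v)]
  simp only [Function.update_self, hrest]
  field_simp
  ring

theorem lyapunov_addTask (s : State n) (v : Fin n) :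
    lyapunov (addTask s v) - lyapunov s = lyapunov s * relIncrease n (s.1 v) := by
  rw [addTask, lyapunov_update, relIncrease, pow_succ]
  congr 2; ring

theorem lyapunov_serve_le (s : State n) (v : Fin n) :
    lyapunov (serve s v) - lyapunov s
      ≤ lyapunov s * (relIncrease n 0 / 2 - relIncrease n (s.1 v) / 2) := by
  rw [serve, lyapunov_update]
  refine mul_le_mul_of_nonneg_left ?_ (lyapunov_pos s).le
  rcases s.1 v with _ | q
  · simp
  · have hserve : ((2 : ℝ) ^ (q + 1 - 1) - 2 ^ (q + 1)) / (8 * (n : ℝ) + 2 ^ (q + 1))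
        = -(relIncrease n (q + 1) / 2) := by
      rw [relIncrease, Nat.add_sub_cancel, pow_succ]; ring
    linarith [relIncrease_nonneg n 0]

theorem shortest_average_le {φ : ℕ → ℝ} (hφ : Monotone φ) (s : State n) (v : Fin n) :
    ((shortest s v).card : ℝ)⁻¹ * ∑ u ∈ shortest s v, φ (s.1 u) ≤ φ (s.1 v) := by
  rw [inv_mul_le_iff₀ (Nat.cast_pos.2 (shortest_nonempty s v).card_pos), ← nsmul_eq_mul]
  refine Finset.sum_le_card_nsmul _ _ _ fun u hu => hφ ?_
  rcases (mem_shortest_iff s v u).1 hu with ⟨rfl, _⟩ | ⟨rfl, h⟩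
  exacts [le_rfl, h]

theorem generator_lyapunov_le_mul (hlam : 0 ≤ lam) (hlam' : lam ≤ 1 / 4) (κ : ℝ) (s : State n) :
    generator lam κ lyapunov s
      ≤ lyapunov s * (1 / 16 - (∑ v, relIncrease n (s.1 v)) / 4) := by
  have hV := lyapunov_pos s
  have hterm : ∀ v, lam * (((shortest s v).card : ℝ)⁻¹ * ∑ u ∈ shortest s v,
        (lyapunov (addTask s u) - lyapunov s)) + (lyapunov (serve s v) - lyapunov s)
      + κ * ((n : ℝ)⁻¹ * ∑ u, (lyapunov (s.1, swapMembership v u s.2) - lyapunov s))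
      ≤ lyapunov s * (relIncrease n 0 / 2 - relIncrease n (s.1 v) / 4) := fun v => by
    have hswap : ∀ M', lyapunov (s.1, M') = lyapunov s := fun _ => rfl
    have harrival : lam * (((shortest s v).card : ℝ)⁻¹ * ∑ u ∈ shortest s v,
        relIncrease n (s.1 u)) ≤ 1 / 4 * relIncrease n (s.1 v) :=
      (mul_le_mul_of_nonneg_left (shortest_average_le (relIncrease_mono n) s v) hlam).trans
        (mul_le_mul_of_nonneg_right hlam' (relIncrease_nonneg _ _))
    simp only [hswap, sub_self, Finset.sum_const_zero, mul_zero, add_zero, lyapunov_addTask,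
      ← Finset.mul_sum]
    rw [mul_left_comm _ (lyapunov s), mul_left_comm _ (lyapunov s)]
    linarith [mul_le_mul_of_nonneg_left harrival hV.le, lyapunov_serve_le s v]
  refine (Finset.sum_le_sum fun v _ => hterm v).trans ?_
  rw [← Finset.mul_sum, Finset.sum_sub_distrib, Finset.sum_const, Finset.card_univ,
    Fintype.card_fin, nsmul_eq_mul, ← Finset.sum_div]
  refine mul_le_mul_of_nonneg_left ?_ hV.le
  linarith [mul_relIncrease_zero_le n]

theorem generator_lyapunov_le (hlam : 0 ≤ lam) (hlam' : lam ≤ 1 / 4) (κ : ℝ) (s : State n) :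
    generator lam κ lyapunov s ≤ (16 * n) ^ n / 8 - 1 / 16 * lyapunov s := by
  have hV := lyapunov_pos s
  have hφ : ∀ v ∈ Finset.univ, 0 ≤ relIncrease n (s.1 v) := fun _ _ => relIncrease_nonneg _ _
  refine (generator_lyapunov_le_mul hlam hlam' κ s).trans ?_
  by_cases hlong : ∃ v, 8 * (n : ℝ) ≤ 2 ^ s.1 v
  · obtain ⟨v, hv⟩ := hlong
    have hhalf : 1 / 2 ≤ relIncrease n (s.1 v) := by
      rw [relIncrease, div_le_div_iff₀ (by norm_num) (by positivity)]
      linarith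
    have hsum := hhalf.trans (Finset.single_le_sum hφ (Finset.mem_univ v))
    have hdecrease : lyapunov s * (1 / 16 - (∑ v, relIncrease n (s.1 v)) / 4)
        ≤ lyapunov s * (-(1 / 16)) := mul_le_mul_of_nonneg_left (by linarith) hV.le
    have hpow : (0 : ℝ) ≤ (16 * n) ^ n / 8 := by positivity
    linarith
  · push Not at hlong
    have hbounded : lyapunov s ≤ (16 * n) ^ n := by
      calc lyapunov s ≤ ∏ _v : Fin n, (16 * (n : ℝ)) :=
            Finset.prod_le_prod (fun _ _ => by positivity) fun v _ => by linarith [hlong v]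
        _ = (16 * n) ^ n := by simp
    have hincrease : lyapunov s * (1 / 16 - (∑ v, relIncrease n (s.1 v)) / 4)
        ≤ lyapunov s * (1 / 16) :=
      mul_le_mul_of_nonneg_left (by linarith [Finset.sum_nonneg hφ]) hV.le
    linarith

theorem exists_isStationary (hlam : 0 ≤ lam) (hlam' : lam ≤ 1 / 4) (hκ : 0 ≤ κ)
    [Nonempty (PerfectMatching n)] : ∃ μ : PMF (State n), IsStationary lam κ μ :=
  (isJumpGenerator_generatorHom hlam hκ n).exists_stationary_pmf (fun s => (lyapunov_pos s).le)
    (finite_lyapunov_le n) (by norm_num) (by positivity) (generator_lyapunov_le hlam hlam' κ)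

theorem tailInd_le_lyapunov (m : Fin n → ℕ) (M : PerfectMatching n) (s : State n) :
    tailInd m M s ≤ lyapunov s * (1 / 2) ^ (∑ v, m v) := by
  by_cases h : ∀ v, m v ≤ s.1 v
  · refine ((le_abs_self _).trans (abs_tailInd_le_one m M s)).trans ?_
    rw [one_div, inv_pow, ← div_eq_mul_inv, le_div_iff₀ (by positivity), one_mul]
    refine le_trans ?_ (two_pow_sum_le_lyapunov s)
    exact pow_le_pow_right₀ one_le_two (Finset.sum_le_sum fun v _ => h v)
  · push Not at h
    obtain ⟨v, hv⟩ := h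
    have hzero : geIndProd m s.1 = 0 := Finset.prod_eq_zero (Finset.mem_univ v) (geInd_of_lt hv)
    rw [tailInd, hzero, ite_self]
    exact mul_nonneg (lyapunov_pos s).le (by positivity)

theorem IsStationary.jointTail_le (hlam : 0 ≤ lam) (hlam' : lam ≤ 1 / 4) (hκ : 0 ≤ κ)
    {μ : PMF (State n)} (hμ : IsStationary lam κ μ) (m : Fin n → ℕ) (M : PerfectMatching n) :
    jointTail μ m M ≤ 2 * (16 * n) ^ n * (1 / 2) ^ (∑ v, m v) := by
  refine Real.tsum_le_of_sum_le (fun s => mul_nonneg ENNReal.toReal_nonneg (tailInd_nonneg m M s))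
    fun S => ?_
  have hmoment := (isJumpGenerator_generatorHom hlam hκ n).sum_stationary_mul_le
    (fun s => (lyapunov_pos s).le) (by norm_num) (by positivity)
    (generator_lyapunov_le hlam hlam' κ) hμ S
  calc ∑ s ∈ S, (μ s).toReal * tailInd m M s
      ≤ ∑ s ∈ S, (μ s).toReal * lyapunov s * (1 / 2) ^ (∑ v, m v) := by
        refine Finset.sum_le_sum fun s _ => ?_
        rw [mul_assoc]
        exact mul_le_mul_of_nonneg_left (tailInd_le_lyapunov m M s) ENNReal.toReal_nonneg
    _ = (∑ s ∈ S, (μ s).toReal * lyapunov s) * (1 / 2) ^ (∑ v, m v) := by rw [Finset.sum_mul]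
    _ ≤ 2 * (16 * n) ^ n * (1 / 2) ^ (∑ v, m v) := by
        refine mul_le_mul_of_nonneg_right (hmoment.trans_eq (by ring)) (by positivity)

end Stationary

section Relabelling

variable {n : ℕ}

theorem exists_perfectMatching (hn : Even n) : Nonempty (PerfectMatching n) := by
  refine ⟨⟨Fin.revPerm, fun v => by simp, fun v hv => ?_⟩⟩
  have hval := congrArg Fin.val hv
  simp only [Fin.revPerm_apply, Fin.val_rev] at hval
  obtain ⟨k, hk⟩ := hn
  omega

/-- The matching `M` transported along the relabelling `σ⁻¹` of the vertices. -/
def relabel (σ : Equiv.Perm (Fin n)) (M : PerfectMatching n) : PerfectMatching n :=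
  ⟨σ⁻¹ * M.1 * σ, fun v => by simp [M.2.1], fun v hv => M.2.2 (σ v) <| by
    rwa [Equiv.Perm.mul_apply, Equiv.Perm.mul_apply, Equiv.Perm.inv_eq_iff_eq] at hv⟩

theorem apply_relabel (σ : Equiv.Perm (Fin n)) (M : PerfectMatching n) (v : Fin n) :
    σ ((relabel σ M).1 v) = M.1 (σ v) := by
  simp [relabel]

theorem relabel_mul (σ τ : Equiv.Perm (Fin n)) (M : PerfectMatching n) :
    relabel (σ * τ) M = relabel τ (relabel σ M) :=
  Subtype.ext <| by simp [relabel, mul_assoc]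

theorem relabel_one (M : PerfectMatching n) : relabel 1 M = M :=
  Subtype.ext <| by simp [relabel]

/-- Relabelling as a permutation of the matchings. -/
def relabelEquiv (σ : Equiv.Perm (Fin n)) : PerfectMatching n ≃ PerfectMatching n where
  toFun := relabel σ
  invFun := relabel σ⁻¹
  left_inv M := by rw [← relabel_mul, mul_inv_cancel, relabel_one]
  right_inv M := by rw [← relabel_mul, inv_mul_cancel, relabel_one]

theorem sum_relabel {β : Type*} [AddCommMonoid β] (σ : Equiv.Perm (Fin n))
    (f : PerfectMatching n → β) : ∑ M, f (relabel σ M) = ∑ M, f M :=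
  Equiv.sum_comp (relabelEquiv σ) f

theorem relabel_swapMembership (σ : Equiv.Perm (Fin n)) (u v : Fin n) (M : PerfectMatching n) :
    relabel σ (swapMembership (σ u) (σ v) M) = swapMembership u v (relabel σ M) := by
  have hright := Equiv.mul_swap_eq_swap_mul σ u v
  have hleft : σ⁻¹ * Equiv.swap (σ u) (σ v) = Equiv.swap u v * σ⁻¹ := by
    rw [inv_mul_eq_iff_eq_mul, ← mul_assoc, hright, mul_inv_cancel_right]
  refine Subtype.ext ?_
  calc σ⁻¹ * (Equiv.swap (σ u) (σ v) * M.1 * Equiv.swap (σ u) (σ v)) * σ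
      = (σ⁻¹ * Equiv.swap (σ u) (σ v)) * M.1 * (Equiv.swap (σ u) (σ v) * σ) := by
        simp only [mul_assoc]
    _ = Equiv.swap u v * (σ⁻¹ * M.1 * σ) * Equiv.swap u v := by
        rw [hleft, ← hright]; simp only [mul_assoc]

theorem setPair_comp (m : Fin n → ℕ) (σ : Equiv.Perm (Fin n)) (v w : Fin n) (i j : ℕ) :
    setPair m (σ v) (σ w) i j ∘ σ = setPair (m ∘ σ) v w i j := by
  ext x
  simp [setPair, Function.update_apply]

theorem single_comp {σ : Equiv.Perm (Fin n)} {i j : Fin n} (h : σ i = j) (k : ℕ) :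
    (Pi.single j k : Fin n → ℕ) ∘ σ = Pi.single i k := by
  subst h
  ext v
  simp [Pi.single_apply]

theorem tailGenerator_relabel (lam κ : ℝ) (D : (Fin n → ℕ) → PerfectMatching n → ℝ)
    (σ : Equiv.Perm (Fin n)) (m : Fin n → ℕ) (M : PerfectMatching n) :
    tailGenerator lam κ (fun m M => D (m ∘ σ) (relabel σ M)) m M
      = tailGenerator lam κ D (m ∘ σ) (relabel σ M) := by
  unfold tailGenerator
  congr 1
  · rw [← Equiv.sum_comp σ]
    simp only [← apply_relabel, setPair_comp, Function.comp]
  · congr 2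
    rw [← Equiv.sum_comp σ]
    refine Finset.sum_congr rfl fun v _ => ?_
    rw [← Equiv.sum_comp σ]
    simp only [relabel_swapMembership]

theorem cycleType_perfectMatching (M : PerfectMatching n) :
    M.1.cycleType = Multiset.replicate (n / 2) 2 := by
  have : Fact (Nat.Prime 2) := ⟨Nat.prime_two⟩
  have hcycle := Equiv.Perm.cycleType_of_pow_prime_eq_one (σ := M.1) (p := 2)
    (Equiv.ext fun v => by simp [pow_two, M.2.1])
  have hsupport : M.1.support = Finset.univ :=
    Finset.eq_univ_of_forall fun v => Equiv.Perm.mem_support.2 (M.2.2 v)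
  have hcard := M.1.sum_cycleType
  rw [hsupport, Finset.card_univ, Fintype.card_fin, hcycle, Multiset.sum_replicate,
    smul_eq_mul] at hcard
  rw [hcycle]
  congr 1
  omega

theorem exists_commute_apply_eq (M : PerfectMatching n) (x i : Fin n) :
    ∃ d : Equiv.Perm (Fin n), Commute d M.1 ∧ d x = i := by
  obtain ⟨hinv, hne⟩ := M.2
  by_cases hx : x = i
  · exact ⟨1, Commute.one_left _, hx⟩
  by_cases hpartner : x = M.1 i
  · exact ⟨M.1, Commute.refl _, by rw [hpartner, hinv]⟩
  have hpartner' : M.1 x ≠ i := fun h => hpartner (by rw [← h, hinv])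
  have hpartners : M.1 x ≠ M.1 i := fun h => hx (M.1.injective h)
  refine ⟨Equiv.swap x i * Equiv.swap (M.1 x) (M.1 i), ?_, ?_⟩
  · have hcomm : Commute (Equiv.swap x i) (Equiv.swap (M.1 x) (M.1 i)) :=
      (Equiv.Perm.disjoint_swap_swap (by simp [hx, (hne x).symm, hpartner, hpartner'.symm,
        (hne i).symm, hpartners])).commute
    have hswap := Equiv.mul_swap_eq_swap_mul M.1 x i
    have hswap' := Equiv.mul_swap_eq_swap_mul M.1 (M.1 x) (M.1 i)
    rw [hinv, hinv] at hswap'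
    rw [commute_iff_eq, mul_assoc, ← hswap, ← mul_assoc, ← mul_assoc, ← hswap', mul_assoc,
      mul_assoc, hcomm.eq]
  · rw [Equiv.Perm.mul_apply, Equiv.swap_apply_of_ne_of_ne (hne x).symm hpartner,
      Equiv.swap_apply_left]

theorem exists_relabel_eq (M M' : PerfectMatching n) (i : Fin n) :
    ∃ τ : Equiv.Perm (Fin n), τ i = i ∧ relabel τ M = M' := by
  have hconj : IsConj M.1 M'.1 := by
    rw [Equiv.Perm.isConj_iff_cycleType_eq, cycleType_perfectMatching, cycleType_perfectMatching]
  obtain ⟨c, hc⟩ := isConj_iff.1 hconj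
  obtain ⟨d, hd, hdi⟩ := exists_commute_apply_eq M' (c i) i
  refine ⟨(d * c)⁻¹, by rw [Equiv.Perm.inv_eq_iff_eq, Equiv.Perm.mul_apply, hdi], Subtype.ext ?_⟩
  calc (d * c)⁻¹⁻¹ * M.1 * (d * c)⁻¹ = d * (c * M.1 * c⁻¹) * d⁻¹ := by
        simp only [inv_inv, mul_inv_rev, mul_assoc]
    _ = M'.1 := by rw [hc, hd.eq, mul_inv_cancel_right]

end Relabelling

section ConditionalTail

variable {n : ℕ} {lam κ : ℝ} {D E : (Fin n → ℕ) → PerfectMatching n → ℝ}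

/-- The system of equations satisfied by the joint tails of the queues under a stationary
distribution, conditioned on the matching. -/
structure IsTailSolution (lam κ : ℝ) (D : (Fin n → ℕ) → PerfectMatching n → ℝ) : Prop where
  bound : ∃ A : ℝ, ∀ m M, |D m M| ≤ A * (1 / 2) ^ (∑ v, m v)
  zero : ∀ M, D 0 M = 1
  generator_eq : ∀ m M, tailGenerator lam κ D m M = 0

theorem IsTailSolution.eq (hlam : 0 ≤ lam) (hlam' : lam ≤ 1 / 100) (hκ : 0 ≤ κ)
    (hD : IsTailSolution lam κ D) (hE : IsTailSolution lam κ E) : D = E := by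
  obtain ⟨A, hA⟩ := hD.bound
  obtain ⟨B, hB⟩ := hE.bound
  ext m M
  have h := abs_le_of_abs_tailGenerator_le hlam hκ (D := fun m M => D m M - E m M)
    (r := 1 / 2) (A := A + B) (ε := 0) (by norm_num) (by norm_num) (by norm_num; linarith)
    (fun m M => ?_) (fun M => by rw [hD.zero, hE.zero, sub_self]) le_rfl
    (fun m M => by rw [tailGenerator_sub, hD.generator_eq, hE.generator_eq]; simp) m M
  · rw [zero_div, zero_mul, abs_nonpos_iff] at h
    exact sub_eq_zero.1 h
  · rw [add_mul]
    exact (abs_sub _ _).trans (add_le_add (hA m M) (hB m M))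

theorem IsTailSolution.relabel (hD : IsTailSolution lam κ D) (σ : Equiv.Perm (Fin n)) :
    IsTailSolution lam κ fun m M => D (m ∘ σ) (Supermarket.relabel σ M) where
  bound := by
    obtain ⟨A, hA⟩ := hD.bound
    exact ⟨A, fun m M => (hA _ _).trans_eq (by simp only [Function.comp, Equiv.sum_comp])⟩
  zero M := hD.zero _
  generator_eq m M := by rw [tailGenerator_relabel, hD.generator_eq]

/-- The tail function of the queue at `i` for the conditional joint tails `D` of all queues and a
uniform matching. -/
noncomputable def queueTail (D : (Fin n → ℕ) → PerfectMatching n → ℝ) (i : Fin n) (k : ℕ) : ℝ :=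
  (Fintype.card (PerfectMatching n) : ℝ)⁻¹ * ∑ M, D (Pi.single i k) M

theorem IsTailSolution.queueTail_eq (hlam : 0 ≤ lam) (hlam' : lam ≤ 1 / 100) (hκ : 0 ≤ κ)
    (hD : IsTailSolution lam κ D) (hE : IsTailSolution lam κ E) (i j : Fin n) :
    queueTail D i = queueTail E j := by
  ext k
  rw [queueTail, queueTail, hD.eq hlam hlam' hκ (hE.relabel (Equiv.swap j i))]
  simp only [single_comp (Equiv.swap_apply_left j i)]
  rw [sum_relabel (Equiv.swap j i) fun M => E (Pi.single j k) M]

theorem sum_jointTail_single (μ : PMF (State n)) (i : Fin n) (k : ℕ) :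
    ∑ M, jointTail μ (Pi.single i k) M = ∑' s, (μ s).toReal * geInd k (s.1 i) := by
  classical
  refine ((hasSum_sum fun M _ => hasSum_jointTail μ (Pi.single i k) M).congr_fun
    fun s => ?_).tsum_eq.symm
  rw [← Finset.mul_sum]
  congr 1
  simp only [tailInd, Finset.sum_ite_eq, Finset.mem_univ, if_true, geIndProd]
  rw [Finset.prod_eq_single i _ (by simp), Pi.single_eq_same]
  intro v _ hv
  rw [Pi.single_eq_of_ne hv, geInd_of_le (Nat.zero_le _)]

/-- The joint tails under `μ`, averaged over the relabellings fixing `i` and conditioned on the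
matching, which is uniform after the averaging. -/
noncomputable def stabilizedTail (μ : PMF (State n)) (i : Fin n) (m : Fin n → ℕ)
    (M : PerfectMatching n) : ℝ :=
  ∑ σ : MulAction.stabilizer (Equiv.Perm (Fin n)) i,
    (Fintype.card (PerfectMatching n) : ℝ) /
      Fintype.card (MulAction.stabilizer (Equiv.Perm (Fin n)) i) * jointTail μ (m ∘ σ) (relabel σ M)

theorem sum_stabilizedTail_single (μ : PMF (State n)) (i : Fin n) (k : ℕ) :
    ∑ M, stabilizedTail μ i (Pi.single i k) M
      = Fintype.card (PerfectMatching n) * ∑ M, jointTail μ (Pi.single i k) M := by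
  have hterm : ∀ σ : MulAction.stabilizer (Equiv.Perm (Fin n)) i,
      ∑ M, jointTail μ (Pi.single i k ∘ σ) (relabel σ M)
        = ∑ M, jointTail μ (Pi.single i k) M := fun σ => by
    rw [single_comp σ.2, sum_relabel σ.1 fun M => jointTail μ (Pi.single i k) M]
  simp only [stabilizedTail]
  rw [Finset.sum_comm]
  simp only [← Finset.mul_sum, hterm, Finset.sum_const, Finset.card_univ, nsmul_eq_mul]
  have hcard : (Fintype.card (MulAction.stabilizer (Equiv.Perm (Fin n)) i) : ℝ) ≠ 0 :=
    Nat.cast_ne_zero.2 Fintype.card_ne_zero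
  field_simp

theorem stabilizedTail_zero_relabel (μ : PMF (State n)) {i : Fin n} {τ : Equiv.Perm (Fin n)}
    (hτ : τ i = i) (M : PerfectMatching n) :
    stabilizedTail μ i 0 (relabel τ M) = stabilizedTail μ i 0 M := by
  refine Fintype.sum_equiv
    (Equiv.mulLeft (⟨τ, hτ⟩ : MulAction.stabilizer (Equiv.Perm (Fin n)) i)) _ _ fun σ => ?_
  simp only [Equiv.coe_mulLeft, Subgroup.coe_mul, relabel_mul]
  rfl

theorem stabilizedTail_zero (μ : PMF (State n)) (i : Fin n) (M : PerfectMatching n) :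
    stabilizedTail μ i 0 M = 1 := by
  have hconst : ∀ M', stabilizedTail μ i 0 M' = stabilizedTail μ i 0 M := fun M' => by
    obtain ⟨τ, hτ, rfl⟩ := exists_relabel_eq M M' i
    exact stabilizedTail_zero_relabel μ hτ M
  have hmass : ∑ M, jointTail μ 0 M = 1 := by
    rw [← Pi.single_zero i, sum_jointTail_single, ← (hasSum_toReal μ).tsum_eq]
    simp [geInd]
  have hsum := sum_stabilizedTail_single μ i 0
  rw [Pi.single_zero, hmass, Finset.sum_congr rfl fun M' _ => hconst M', Finset.sum_const,
    Finset.card_univ, nsmul_eq_mul] at hsum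
  have : Nonempty (PerfectMatching n) := ⟨M⟩
  exact mul_left_cancel₀ (Nat.cast_ne_zero.2 Fintype.card_ne_zero) hsum

theorem IsStationary.isTailSolution_stabilizedTail (hlam : 0 ≤ lam) (hlam' : lam ≤ 1 / 4)
    (hκ : 0 ≤ κ) {μ : PMF (State n)} (hμ : IsStationary lam κ μ) (i : Fin n) :
    IsTailSolution lam κ (stabilizedTail μ i) where
  bound := by
    refine ⟨∑ _σ : MulAction.stabilizer (Equiv.Perm (Fin n)) i,
      (Fintype.card (PerfectMatching n) : ℝ) /
      Fintype.card (MulAction.stabilizer (Equiv.Perm (Fin n)) i) * (2 * (16 * n) ^ n),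
      fun m M => ?_⟩
    rw [stabilizedTail, Finset.sum_mul]
    refine (Finset.abs_sum_le_sum_abs _ _).trans (Finset.sum_le_sum fun σ _ => ?_)
    rw [abs_of_nonneg (mul_nonneg (by positivity) (jointTail_nonneg _ _ _)), mul_assoc]
    refine mul_le_mul_of_nonneg_left ?_ (by positivity)
    exact (hμ.jointTail_le hlam hlam' hκ _ _).trans_eq
      (by simp only [Function.comp, Equiv.sum_comp])
  zero := stabilizedTail_zero μ i
  generator_eq m M := by
    have haverage : ∀ m M, HasSum (fun σ : MulAction.stabilizer (Equiv.Perm (Fin n)) i =>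
        (Fintype.card (PerfectMatching n) : ℝ) /
          Fintype.card (MulAction.stabilizer (Equiv.Perm (Fin n)) i) *
            jointTail μ (m ∘ σ) (Supermarket.relabel σ M)) (stabilizedTail μ i m M) :=
      fun m M => hasSum_fintype _
    rw [← (hasSum_tailGenerator lam κ haverage m M).tsum_eq]
    simp only [tailGenerator_relabel, hμ.tailGenerator_jointTail, mul_zero, tsum_zero]

theorem queueTail_stabilizedTail [Nonempty (PerfectMatching n)] (μ : PMF (State n)) (i : Fin n)
    (k : ℕ) :
    queueTail (stabilizedTail μ i) i k = ∑' s, (μ s).toReal * geInd k (s.1 i) := by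
  rw [queueTail, sum_stabilizedTail_single, sum_jointTail_single,
    inv_mul_cancel_left₀ (Nat.cast_ne_zero.2 Fintype.card_ne_zero)]

end ConditionalTail

section PairProduct

variable {n : ℕ} {F : ℕ → ℕ → ℝ}

/-- The factor of the matched pair of `w` in `pairProd`, assigned to the smaller of the two
vertices. -/
noncomputable def pairFactor (F : ℕ → ℕ → ℝ) (m : Fin n → ℕ) (M : PerfectMatching n) (w : Fin n) :
    ℝ := if w < M.1 w then F (m w) (m (M.1 w)) else 1

/-- The joint tail function of all queues when distinct matched pairs are independent and every
matched pair has joint tail function `F`. -/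
noncomputable def pairProd (F : ℕ → ℕ → ℝ) (m : Fin n → ℕ) (M : PerfectMatching n) : ℝ :=
  ∏ w, pairFactor F m M w

/-- The product `pairProd` without the factor of the matched pair of `v`. -/
noncomputable def pairProdExcept (F : ℕ → ℕ → ℝ) (m : Fin n → ℕ) (M : PerfectMatching n)
    (v : Fin n) : ℝ := ∏ w ∈ (Finset.univ.erase v).erase (M.1 v), pairFactor F m M w

/-- The product `pairProd` without the factors of the matched pairs of `v` and `u`, which are
meant to be distinct pairs. -/
noncomputable def pairProdExceptTwo (F : ℕ → ℕ → ℝ) (m : Fin n → ℕ) (M : PerfectMatching n)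
    (v u : Fin n) : ℝ :=
  ∏ w ∈ (((Finset.univ.erase v).erase (M.1 v)).erase u).erase (M.1 u), pairFactor F m M w

theorem prod_pairFactor (hF : ∀ a b, F a b = F b a) (m : Fin n → ℕ) (M : PerfectMatching n)
    {S : Finset (Fin n)} {v : Fin n} (hv : v ∈ S) (hv' : M.1 v ∈ S) :
    ∏ x ∈ S, pairFactor F m M x
      = F (m v) (m (M.1 v)) * ∏ x ∈ (S.erase v).erase (M.1 v), pairFactor F m M x := by
  have hne := M.2.2 v
  rw [← Finset.mul_prod_erase _ _ hv,
    ← Finset.mul_prod_erase _ _ (Finset.mem_erase.2 ⟨hne, hv'⟩), ← mul_assoc]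
  congr 1
  simp only [pairFactor, M.2.1]
  rcases lt_or_gt_of_ne hne with h | h
  · rw [if_neg (not_lt.2 h.le), if_pos h, one_mul, hF]
  · rw [if_pos h, if_neg (not_lt.2 h.le), mul_one]

theorem pairProd_eq_mul (hF : ∀ a b, F a b = F b a) (m : Fin n → ℕ) (M : PerfectMatching n)
    (v : Fin n) : pairProd F m M = F (m v) (m (M.1 v)) * pairProdExcept F m M v :=
  prod_pairFactor hF m M (Finset.mem_univ _) (Finset.mem_univ _)

theorem pairProdExcept_eq_mul (hF : ∀ a b, F a b = F b a) (m : Fin n → ℕ) (M : PerfectMatching n)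
    {u v : Fin n} (huv : u ≠ v) (huv' : u ≠ M.1 v) :
    pairProdExcept F m M v = F (m u) (m (M.1 u)) * pairProdExceptTwo F m M v u := by
  have hpartners : M.1 u ≠ M.1 v := fun h => huv (M.1.injective h)
  have hpartner : M.1 u ≠ v := fun h => huv' (by rw [← h, M.2.1])
  exact prod_pairFactor hF m M (by simp [huv, huv']) (by simp [hpartners, hpartner])

theorem pairProdExceptTwo_comm (F : ℕ → ℕ → ℝ) (m : Fin n → ℕ) (M : PerfectMatching n)
    (v u : Fin n) : pairProdExceptTwo F m M v u = pairProdExceptTwo F m M u v := by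
  refine Finset.prod_congr ?_ fun _ _ => rfl
  ext x
  simp only [Finset.mem_erase]
  tauto

theorem pairProdExcept_partner (F : ℕ → ℕ → ℝ) (m : Fin n → ℕ) (M : PerfectMatching n)
    (v : Fin n) : pairProdExcept F m M (M.1 v) = pairProdExcept F m M v := by
  rw [pairProdExcept, pairProdExcept, M.2.1, Finset.erase_right_comm]

theorem pairProdExcept_setPair (F : ℕ → ℕ → ℝ) (m : Fin n → ℕ) (M : PerfectMatching n)
    (v : Fin n) (i j : ℕ) :
    pairProdExcept F (setPair m v (M.1 v) i j) M v = pairProdExcept F m M v := by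
  refine Finset.prod_congr rfl fun w hw => ?_
  simp only [Finset.mem_erase, Finset.mem_univ, and_true] at hw
  have hpartners : M.1 w ≠ M.1 v := fun h => hw.2 (M.1.injective h)
  have hpartner : M.1 w ≠ v := fun h => hw.1 (by rw [← h, M.2.1])
  simp [pairFactor, setPair, hw.1, hw.2, hpartners, hpartner]

theorem pairProd_setPair (hF : ∀ a b, F a b = F b a) (m : Fin n → ℕ) (M : PerfectMatching n)
    (v : Fin n) (i j : ℕ) :
    pairProd F (setPair m v (M.1 v) i j) M = F i j * pairProdExcept F m M v := by
  rw [pairProd_eq_mul hF _ M v, pairProdExcept_setPair]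
  simp [setPair, (M.2.2 v).symm]

theorem pairProd_pow (r : ℝ) (m : Fin n → ℕ) (M : PerfectMatching n) :
    pairProd (fun a b => r ^ (a + b)) m M = r ^ (∑ v, m v) := by
  have hfactor : ∀ w, pairFactor (fun a b => r ^ (a + b)) m M w
      = (if w < M.1 w then r ^ m w else 1) * (if w < M.1 w then r ^ m (M.1 w) else 1) := by
    intro w
    rw [pairFactor]
    split_ifs
    exacts [pow_add _ _ _, (mul_one 1).symm]
  have hlarger : ∏ w, (if w < M.1 w then r ^ m (M.1 w) else 1)
      = ∏ w, (if M.1 w < w then r ^ m w else 1) := by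
    rw [← Equiv.prod_comp M.1 fun w => if M.1 w < w then r ^ m w else 1]
    simp only [M.2.1]
  simp only [pairProd, hfactor]
  rw [Finset.prod_mul_distrib, hlarger, ← Finset.prod_mul_distrib, ← Finset.prod_pow_eq_pow_sum]
  refine Finset.prod_congr rfl fun w _ => ?_
  rcases lt_or_gt_of_ne (M.2.2 w) with h | h
  · rw [if_neg (not_lt.2 h.le), if_pos h, one_mul]
  · rw [if_pos h, if_neg (not_lt.2 h.le), mul_one]

theorem abs_prod_pairFactor_le {G : ℕ → ℕ → ℝ} (h : ∀ a b, |F a b| ≤ G a b) (m : Fin n → ℕ)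
    (M : PerfectMatching n) (S : Finset (Fin n)) :
    |∏ x ∈ S, pairFactor F m M x| ≤ ∏ x ∈ S, pairFactor G m M x := by
  rw [Finset.abs_prod]
  refine Finset.prod_le_prod (fun _ _ => abs_nonneg _) fun x _ => ?_
  unfold pairFactor
  split_ifs
  exacts [h _ _, abs_one.le]

theorem abs_pairProd_le {r : ℝ} (h : ∀ a b, |F a b| ≤ r ^ (a + b)) (m : Fin n → ℕ)
    (M : PerfectMatching n) : |pairProd F m M| ≤ r ^ (∑ v, m v) :=
  (abs_prod_pairFactor_le h m M _).trans_eq (pairProd_pow r m M)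

theorem pow_mul_abs_pairProdExcept_le {r : ℝ} (h : ∀ a b, |F a b| ≤ r ^ (a + b)) (m : Fin n → ℕ)
    (M : PerfectMatching n) (v : Fin n) :
    r ^ (m v + m (M.1 v)) * |pairProdExcept F m M v| ≤ r ^ (∑ v, m v) := by
  rw [← pairProd_pow r m M, pairProd_eq_mul (fun a b => by rw [add_comm]) m M v]
  exact mul_le_mul_of_nonneg_left (abs_prod_pairFactor_le h m M _) ((abs_nonneg _).trans (h _ _))

theorem pow_mul_abs_pairProdExceptTwo_le {r : ℝ} (h : ∀ a b, |F a b| ≤ r ^ (a + b))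
    (m : Fin n → ℕ) (M : PerfectMatching n) {u v : Fin n} (huv : u ≠ v) (huv' : u ≠ M.1 v) :
    r ^ (m v + m (M.1 v)) * r ^ (m u + m (M.1 u)) * |pairProdExceptTwo F m M v u|
      ≤ r ^ (∑ v, m v) := by
  have hcomm : ∀ a b : ℕ, r ^ (a + b) = r ^ (b + a) := fun a b => by rw [add_comm]
  have hr : ∀ a b : ℕ, 0 ≤ r ^ (a + b) := fun a b => (abs_nonneg _).trans (h a b)
  rw [← pairProd_pow r m M, pairProd_eq_mul hcomm m M v,
    pairProdExcept_eq_mul hcomm m M huv huv', mul_assoc]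
  exact mul_le_mul_of_nonneg_left
    (mul_le_mul_of_nonneg_left (abs_prod_pairFactor_le h m M _) (hr _ _)) (hr _ _)

theorem pairProd_single (h₀ : F 0 0 = 1) (hF : ∀ a b, F a b = F b a) (M : PerfectMatching n)
    (i : Fin n) (k : ℕ) : pairProd F (Pi.single i k) M = F k 0 := by
  rw [pairProd_eq_mul hF _ M i, Pi.single_eq_same, Pi.single_eq_of_ne (M.2.2 i), pairProdExcept,
    Finset.prod_eq_one, mul_one]
  intro w hw
  simp only [Finset.mem_erase, Finset.mem_univ, and_true] at hw
  have hpartner : M.1 w ≠ i := fun h => hw.1 (by rw [← h, M.2.1])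
  simp [pairFactor, hw.2, hpartner, h₀]

theorem swapMembership_self (v : Fin n) (M : PerfectMatching n) : swapMembership v v M = M := by
  refine Subtype.ext ?_
  change Equiv.swap v v * M.1 * Equiv.swap v v = M.1
  rw [Equiv.swap_self]
  rfl

theorem swapMembership_partner (v : Fin n) (M : PerfectMatching n) :
    swapMembership v (M.1 v) M = M := by
  have h := Equiv.mul_swap_eq_swap_mul M.1 v (M.1 v)
  rw [M.2.1, Equiv.swap_comm (M.1 v) v] at h
  refine Subtype.ext ?_
  change Equiv.swap v (M.1 v) * M.1 * Equiv.swap v (M.1 v) = M.1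
  rw [mul_assoc, h, ← mul_assoc, Equiv.swap_mul_self, one_mul]

theorem swapMembership_apply (u v w : Fin n) (M : PerfectMatching n) :
    (swapMembership u v M).1 w = Equiv.swap u v (M.1 (Equiv.swap u v w)) := rfl

theorem pairProd_swapMembership (hF : ∀ a b, F a b = F b a) (m : Fin n → ℕ)
    (M : PerfectMatching n) {u v : Fin n} (huv : u ≠ v) (huv' : u ≠ M.1 v) :
    pairProd F m (swapMembership v u M) = F (m v) (m (M.1 u)) * F (m u) (m (M.1 v)) *
      pairProdExceptTwo F m M v u := by
  have hpartner : M.1 u ≠ v := fun h => huv' (by rw [← h, M.2.1])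
  have hv : (swapMembership v u M).1 v = M.1 u := by
    rw [swapMembership_apply, Equiv.swap_apply_left,
      Equiv.swap_apply_of_ne_of_ne hpartner (M.2.2 u)]
  have hu : (swapMembership v u M).1 u = M.1 v := by
    rw [swapMembership_apply, Equiv.swap_apply_right,
      Equiv.swap_apply_of_ne_of_ne (M.2.2 v) huv'.symm]
  rw [pairProd_eq_mul hF m _ v, pairProdExcept_eq_mul hF m _ huv (hv ▸ (M.2.2 u).symm), hv, hu,
    mul_assoc]
  congr 2
  have herase : (((Finset.univ.erase v).erase (M.1 u)).erase u).erase (M.1 v)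
      = (((Finset.univ.erase v).erase (M.1 v)).erase u).erase (M.1 u) := by
    ext x; simp only [Finset.mem_erase]; tauto
  rw [pairProdExceptTwo, hv, hu, herase]
  refine Finset.prod_congr rfl fun x hx => ?_
  simp only [Finset.mem_erase, Finset.mem_univ, and_true] at hx
  obtain ⟨hxu', hxu, hxv', hxv⟩ := hx
  have hx : (swapMembership v u M).1 x = M.1 x := by
    rw [swapMembership_apply, Equiv.swap_apply_of_ne_of_ne hxv hxu,
      Equiv.swap_apply_of_ne_of_ne (fun h => hxv' (by rw [← h, M.2.1]))
        fun h => hxu' (by rw [← h, M.2.1])]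
  simp only [pairFactor, hx]

end PairProduct

section PairApproximation

variable {n : ℕ} {lam κ : ℝ} {F : ℕ → ℕ → ℝ}

theorem correlation_comm (hF : ∀ a b, F a b = F b a) (a b : ℕ) :
    correlation F a b = correlation F b a := by
  rw [correlation, correlation, hF a b, mul_comm]

/-- The decrease of `pairProd` when the queues of the matched pair of `v` are made independent. -/
noncomputable def pairCorrelation (F : ℕ → ℕ → ℝ) (m : Fin n → ℕ) (M : PerfectMatching n)
    (v : Fin n) : ℝ := correlation F (m v) (m (M.1 v)) * pairProdExcept F m M v

/-- The difference between the effect of a swap of `v` and `u` on `pairProd` and the effect it has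
in an infinite system, where it makes both of the matched pairs independent. -/
noncomputable def swapError (κ : ℝ) (F : ℕ → ℕ → ℝ) (m : Fin n → ℕ) (M : PerfectMatching n)
    (v u : Fin n) : ℝ :=
  κ * (pairProd F m (swapMembership v u M) - pairProd F m M
    + (pairCorrelation F m M v + pairCorrelation F m M u))

theorem activeInd_mul_mul_le (a b c d : ℕ) :
    activeInd a * activeInd b * (activeInd c * activeInd d) ≤ activeInd a * activeInd c := by
  rw [mul_mul_mul_comm]
  exact mul_le_of_le_one_right (mul_nonneg (activeInd_nonneg a) (activeInd_nonneg c))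
    (mul_le_one₀ (activeInd_le_one b) (activeInd_nonneg d) (activeInd_le_one d))

theorem exchange_eq (hF : ∀ a b, F a b = F b a) (a b c d : ℕ) :
    κ * (F a d * F c b - F a b * F c d + (correlation F a b * F c d + correlation F c d * F a b))
      = κ * correlation F a d * (F c 0 * F b 0) + κ * correlation F b c * (F a 0 * F d 0)
        + κ * correlation F a d * correlation F b c
        + κ * correlation F a b * correlation F c d := by
  simp only [correlation, hF b c]
  ring

theorem IsPairTail.abs_exchange_le (hlam : 0 ≤ lam) (hlam' : lam ≤ 1 / 2000)
    (hF : IsPairTail lam κ F) (a b c d : ℕ) :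
    |κ * (F a d * F c b - F a b * F c d
        + (correlation F a b * F c d + correlation F c d * F a b))|
      ≤ 1 / 100 * (2 * (activeInd a * activeInd d) + activeInd b * activeInd c
          + activeInd a * activeInd c) * ((1 / 4) ^ (a + b) * (1 / 4) ^ (c + d)) := by
  have hcorr : ∀ (p q : ℕ) {t w : ℝ}, |t| ≤ w → |κ * correlation F p q * t|
      ≤ activeInd p * activeInd q * (1 / 100 * (1 / 4) ^ (p + q)) * w := fun p q t w ht => by
    have h := hF.abs_mul_correlation_le hlam hlam' p q
    rw [abs_mul]
    exact mul_le_mul h ht (abs_nonneg t) ((abs_nonneg _).trans h)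
  have hmarginal : ∀ p q, |F p 0 * F q 0| ≤ (1 / 4) ^ p * (1 / 4) ^ q := fun p q => by
    rw [abs_mul]
    exact mul_le_mul (hF.abs_le_pow (by norm_num) p 0) (hF.abs_le_pow (by norm_num) q 0)
      (abs_nonneg _) (by positivity)
  have hcorr_le : |correlation F b c| ≤ (1 / 4) ^ (b + c) := by
    refine (hF.abs_correlation_le b c).trans (mul_le_of_le_one_left (by positivity) ?_)
    exact mul_le_one₀ (activeInd_le_one b) (activeInd_nonneg c) (activeInd_le_one c)
  have had := hcorr a d (hmarginal c b)
  have hbc := hcorr b c (hmarginal a d)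
  have hadbc := hcorr a d hcorr_le
  have habcd := hcorr a b (hF.abs_correlation_le c d)
  have hactive := mul_le_mul_of_nonneg_right (activeInd_mul_mul_le a b c d)
    (by positivity : (0 : ℝ) ≤ 1 / 100 * ((1 / 4) ^ (a + b) * (1 / 4) ^ (c + d)))
  rw [exchange_eq hF.comm]
  refine (abs_add_le _ _).trans ((add_le_add_left (abs_add_three _ _ _) _).trans ?_)
  simp only [pow_add] at *
  linarith

theorem IsPairTail.abs_mul_pairCorrelation_le (hlam : 0 ≤ lam) (hlam' : lam ≤ 1 / 2000)
    (hF : IsPairTail lam κ F) (m : Fin n → ℕ) (M : PerfectMatching n) (v : Fin n) :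
    |κ * pairCorrelation F m M v|
      ≤ 1 / 100 * (activeInd (m v) * activeInd (m (M.1 v))) * (1 / 4) ^ (∑ v, m v) := by
  have hactive := mul_nonneg (activeInd_nonneg (m v)) (activeInd_nonneg (m (M.1 v)))
  rw [pairCorrelation, ← mul_assoc, abs_mul]
  refine (mul_le_mul_of_nonneg_right (hF.abs_mul_correlation_le hlam hlam' _ _)
    (abs_nonneg _)).trans ?_
  have h := mul_le_mul_of_nonneg_left
    (pow_mul_abs_pairProdExcept_le (hF.abs_le_pow (by norm_num)) m M v) hactive
  linarith

theorem swapError_eq_mul (hF : ∀ a b, F a b = F b a) (m : Fin n → ℕ) (M : PerfectMatching n)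
    {u v : Fin n} (huv : u ≠ v) (huv' : u ≠ M.1 v) :
    swapError κ F m M v u = κ * (F (m v) (m (M.1 u)) * F (m u) (m (M.1 v))
        - F (m v) (m (M.1 v)) * F (m u) (m (M.1 u))
        + (correlation F (m v) (m (M.1 v)) * F (m u) (m (M.1 u))
          + correlation F (m u) (m (M.1 u)) * F (m v) (m (M.1 v))))
      * pairProdExceptTwo F m M v u := by
  have hvu : v ≠ M.1 u := fun h => huv' (by rw [h, M.2.1])
  rw [swapError, pairProd_swapMembership hF m M huv huv', pairCorrelation, pairCorrelation,
    pairProd_eq_mul hF m M v, pairProdExcept_eq_mul hF m M huv huv',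
    pairProdExcept_eq_mul hF m M (Ne.symm huv) hvu, pairProdExceptTwo_comm F m M u v]
  ring

theorem IsPairTail.abs_swapError_le (hlam : 0 ≤ lam) (hlam' : lam ≤ 1 / 2000)
    (hF : IsPairTail lam κ F) (m : Fin n → ℕ) (M : PerfectMatching n) (v u : Fin n) :
    |swapError κ F m M v u| ≤ 1 / 100 * (2 * (activeInd (m v) * activeInd (m (M.1 u)))
        + activeInd (m (M.1 v)) * activeInd (m u) + activeInd (m v) * activeInd (m u))
      * (1 / 4) ^ (∑ v, m v) := by
  have hv := activeInd_nonneg (m v)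
  have hv' := activeInd_nonneg (m (M.1 v))
  have hcorr := hF.abs_mul_pairCorrelation_le hlam hlam' m M v
  have hdouble : |κ * (pairCorrelation F m M v + pairCorrelation F m M v)|
      ≤ 1 / 100 * (2 * (activeInd (m v) * activeInd (m (M.1 v)))) * (1 / 4) ^ (∑ v, m v) := by
    rw [← two_mul, mul_left_comm, abs_mul, abs_two]
    linarith
  by_cases huv : u = v
  · subst huv
    rw [swapError, swapMembership_self, sub_self, zero_add]
    refine hdouble.trans (mul_le_mul_of_nonneg_right ?_ (by positivity))
    linarith [mul_nonneg hv' hv, mul_nonneg hv hv]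
  by_cases huv' : u = M.1 v
  · subst huv'
    have hpartner : pairCorrelation F m M (M.1 v) = pairCorrelation F m M v := by
      rw [pairCorrelation, M.2.1, correlation_comm hF.comm, pairProdExcept_partner, pairCorrelation]
    rw [swapError, swapMembership_partner, sub_self, zero_add, hpartner, M.2.1]
    refine hdouble.trans (mul_le_mul_of_nonneg_right ?_ (by positivity))
    nlinarith [sq_nonneg (activeInd (m v) - activeInd (m (M.1 v)))]
  rw [swapError_eq_mul hF.comm m M huv huv', abs_mul]
  refine (mul_le_mul_of_nonneg_right (hF.abs_exchange_le hlam hlam' _ _ _ _)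
    (abs_nonneg _)).trans ?_
  rw [mul_assoc]
  refine mul_le_mul_of_nonneg_left ?_ ?_
  · exact pow_mul_abs_pairProdExceptTwo_le (hF.abs_le_pow (by norm_num)) m M huv huv'
  · have hu := activeInd_nonneg (m u)
    have hu' := activeInd_nonneg (m (M.1 u))
    positivity

theorem IsPairTail.sum_tailDrift_pairProd (hF : IsPairTail lam κ F) (m : Fin n → ℕ)
    (M : PerfectMatching n) :
    ∑ v, tailDrift lam (fun i j => pairProd F (setPair m v (M.1 v) i j) M) (m v) (m (M.1 v))
      = 2 * κ * ∑ v, pairCorrelation F m M v := by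
  set t : Fin n → ℝ := fun v => tailDrift lam F (m v) (m (M.1 v)) * pairProdExcept F m M v with ht
  have hpartner : ∑ v, t (M.1 v) = ∑ v, t v := Equiv.sum_comp M.1 t
  have hpair : ∑ v, (t v + t (M.1 v)) = ∑ v, 4 * κ * pairCorrelation F m M v := by
    refine Finset.sum_congr rfl fun v _ => ?_
    simp only [ht, M.2.1, pairProdExcept_partner, pairCorrelation]
    linear_combination pairProdExcept F m M v * hF.balance (m v) (m (M.1 v))
  rw [Finset.sum_add_distrib, hpartner, ← Finset.mul_sum] at hpair
  simp only [pairProd_setPair hF.comm, tailDrift_mul_right]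
  change ∑ v, t v = _
  linarith

theorem IsPairTail.tailGenerator_pairProd (hF : IsPairTail lam κ F) (m : Fin n → ℕ)
    (M : PerfectMatching n) :
    tailGenerator lam κ (pairProd F) m M = (n : ℝ)⁻¹ * ∑ v, ∑ u, swapError κ F m M v u := by
  rcases n.eq_zero_or_pos with rfl | hn
  · simp [tailGenerator]
  have hn' : (n : ℝ) ≠ 0 := by exact_mod_cast hn.ne'
  have hcorr : ∑ v : Fin n, ∑ u : Fin n, (pairCorrelation F m M v + pairCorrelation F m M u)
      = 2 * n * ∑ v, pairCorrelation F m M v := by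
    simp only [Finset.sum_add_distrib, Finset.sum_const, Finset.card_univ, Fintype.card_fin,
      nsmul_eq_mul, ← Finset.mul_sum]
    ring
  simp only [swapError, ← Finset.mul_sum]
  simp only [Finset.sum_add_distrib (f := fun u => pairProd F m (swapMembership _ u M) - _)]
  rw [Finset.sum_add_distrib, hcorr, tailGenerator, hF.sum_tailDrift_pairProd]
  field_simp
  ring

theorem active_mul_pow_le (m : Fin n → ℕ) :
    active m * (1 / 4) ^ (∑ v, m v) ≤ (1 / 2) ^ (∑ v, m v) := by
  have hsum : active m ≤ ((∑ v, m v : ℕ) : ℝ) := by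
    rw [active, Nat.cast_sum]
    refine Finset.sum_le_sum fun v _ => ?_
    unfold activeInd
    split_ifs with h
    · exact Nat.cast_nonneg _
    · exact_mod_cast Nat.one_le_iff_ne_zero.2 h
  have hpow : active m ≤ 2 ^ (∑ v, m v) := hsum.trans (by exact_mod_cast Nat.lt_two_pow_self.le)
  calc active m * (1 / 4) ^ (∑ v, m v) ≤ 2 ^ (∑ v, m v) * (1 / 4) ^ (∑ v, m v) := by gcongr
    _ = (1 / 2) ^ (∑ v, m v) := by rw [← mul_pow]; norm_num

theorem IsPairTail.abs_tailGenerator_pairProd_le (hlam : 0 ≤ lam) (hlam' : lam ≤ 1 / 2000)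
    (hF : IsPairTail lam κ F) (m : Fin n → ℕ) (M : PerfectMatching n) :
    |tailGenerator lam κ (pairProd F) m M|
      ≤ active m * (1 / (25 * n) * (1 / 2) ^ (∑ v, m v)) := by
  have hpartner : ∑ v, activeInd (m (M.1 v)) = active m :=
    Equiv.sum_comp M.1 fun v => activeInd (m v)
  have hactive : ∑ v, activeInd (m v) = active m := rfl
  rw [hF.tailGenerator_pairProd, abs_mul, abs_of_nonneg (by positivity : (0 : ℝ) ≤ (n : ℝ)⁻¹)]
  calc (n : ℝ)⁻¹ * |∑ v, ∑ u, swapError κ F m M v u|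
      ≤ (n : ℝ)⁻¹ * ∑ v, ∑ u, 1 / 100 * (2 * (activeInd (m v) * activeInd (m (M.1 u)))
          + activeInd (m (M.1 v)) * activeInd (m u) + activeInd (m v) * activeInd (m u))
        * (1 / 4) ^ (∑ v, m v) := by
        refine mul_le_mul_of_nonneg_left ?_ (by positivity)
        refine (Finset.abs_sum_le_sum_abs _ _).trans (Finset.sum_le_sum fun v _ => ?_)
        exact (Finset.abs_sum_le_sum_abs _ _).trans
          (Finset.sum_le_sum fun u _ => hF.abs_swapError_le hlam hlam' m M v u)
    _ = (n : ℝ)⁻¹ * (1 / 25) * active m * (active m * (1 / 4) ^ (∑ v, m v)) := by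
        simp only [← Finset.mul_sum, ← Finset.sum_mul, Finset.sum_add_distrib, hpartner,
          hactive]
        ring
    _ ≤ (n : ℝ)⁻¹ * (1 / 25) * active m * (1 / 2) ^ (∑ v, m v) :=
        mul_le_mul_of_nonneg_left (active_mul_pow_le m)
          (mul_nonneg (by positivity) (active_nonneg m))
    _ = active m * (1 / (25 * n) * (1 / 2) ^ (∑ v, m v)) := by
        rw [one_div (25 * (n : ℝ)), mul_inv]; ring

theorem IsTailSolution.abs_sub_pairProd_le (hlam : 0 ≤ lam) (hlam' : lam ≤ 1 / 2000) (hκ : 0 ≤ κ)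
    (hF : IsPairTail lam κ F) {D : (Fin n → ℕ) → PerfectMatching n → ℝ}
    (hD : IsTailSolution lam κ D) (m : Fin n → ℕ) (M : PerfectMatching n) :
    |D m M - pairProd F m M| ≤ 4 / (25 * n) * (1 / 2) ^ (∑ v, m v) := by
  obtain ⟨A, hA⟩ := hD.bound
  have hhalf : ∀ a b, |F a b| ≤ (1 / 2) ^ (a + b) := fun a b =>
    (hF.abs_le_pow (by norm_num) a b).trans (pow_le_pow_left₀ (by norm_num) (by norm_num) _)
  have hzero : ∀ M : PerfectMatching n, pairProd F 0 M = 1 := fun M => by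
    simp [pairProd, pairFactor, hF.zero]
  refine (abs_le_of_abs_tailGenerator_le hlam hκ (D := fun m M => D m M - pairProd F m M)
    (r := 1 / 2) (A := A + 1) (ε := 1 / (25 * n)) (by norm_num) (by norm_num)
    (by norm_num; linarith) (fun m M => ?_) (fun M => by rw [hD.zero, hzero, sub_self])
    (by positivity) (fun m M => ?_) m M).trans (mul_le_mul_of_nonneg_right ?_ (by positivity))
  · rw [add_mul, one_mul]
    exact (abs_sub _ _).trans (add_le_add (hA m M) (abs_pairProd_le hhalf m M))
  · rw [tailGenerator_sub, hD.generator_eq, zero_sub, abs_neg]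
    exact hF.abs_tailGenerator_pairProd_le hlam hlam' m M
  · rw [div_le_iff₀ (by norm_num; linarith), div_mul_eq_mul_div]
    exact div_le_div_of_nonneg_right (by norm_num; linarith) (by positivity)

theorem abs_queueTail_sub_le [Nonempty (PerfectMatching n)]
    {D : (Fin n → ℕ) → PerfectMatching n → ℝ} {i : Fin n} {k : ℕ} {x c : ℝ}
    (h : ∀ M, |D (Pi.single i k) M - x| ≤ c) : |queueTail D i k - x| ≤ c := by
  have hcard : (0 : ℝ) < Fintype.card (PerfectMatching n) := by exact_mod_cast Fintype.card_pos
  have hmean : queueTail D i k - x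
      = (Fintype.card (PerfectMatching n) : ℝ)⁻¹ * ∑ M, (D (Pi.single i k) M - x) := by
    rw [Finset.sum_sub_distrib, Finset.sum_const, Finset.card_univ, nsmul_eq_mul, mul_sub,
      inv_mul_cancel_left₀ hcard.ne', queueTail]
  rw [hmean, abs_mul, abs_of_pos (inv_pos.2 hcard), inv_mul_le_iff₀ hcard, ← nsmul_eq_mul]
  exact (Finset.abs_sum_le_sum_abs _ _).trans (Finset.sum_le_card_nsmul _ _ _ fun M _ => h M)

theorem IsTailSolution.abs_queueTail_sub_le (hlam : 0 ≤ lam) (hlam' : lam ≤ 1 / 2000) (hκ : 0 ≤ κ)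
    (hF : IsPairTail lam κ F) [Nonempty (PerfectMatching n)]
    {D : (Fin n → ℕ) → PerfectMatching n → ℝ} (hD : IsTailSolution lam κ D) (i : Fin n) (k : ℕ) :
    |queueTail D i k - F k 0| ≤ 4 / (25 * n) * (1 / 2) ^ k := by
  refine Supermarket.abs_queueTail_sub_le fun M => ?_
  have h := hD.abs_sub_pairProd_le hlam hlam' hκ hF (Pi.single i k) M
  rwa [pairProd_single hF.zero hF.comm, Finset.sum_pi_single', if_pos (Finset.mem_univ i)] at h

end PairApproximation

section QueueLaw

theorem toReal_map_apply {α : Type*} (μ : PMF α) (f : α → ℕ) (x : ℕ) :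
    ((μ.map f) x).toReal = (∑' s, (μ s).toReal * geInd x (f s))
      - ∑' s, (μ s).toReal * geInd (x + 1) (f s) := by
  have hbound : ∀ k s, |geInd k (f s)| ≤ 1 := fun k s =>
    (abs_of_nonneg (geInd_nonneg k (f s))).trans_le (geInd_le_one k (f s))
  rw [← (summable_toReal_mul μ (hbound x)).tsum_sub (summable_toReal_mul μ (hbound (x + 1))),
    PMF.map_apply, ENNReal.tsum_toReal_eq fun s => by split_ifs <;> simp [μ.apply_ne_top]]
  refine tsum_congr fun s => ?_
  rw [← mul_sub]
  rcases lt_trichotomy x (f s) with h | h | h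
  · simp [h.ne, geInd_of_le h.le, geInd_of_le (Nat.succ_le_of_lt h)]
  · simp [h, geInd_of_le le_rfl, geInd_of_lt (Nat.lt_succ_self (f s))]
  · simp [h.ne', geInd_of_lt h, geInd_of_lt (Nat.lt_succ_of_lt h)]

theorem hasSum_indicator_toReal_apply (p : PMF ℕ) (A : Set ℕ) :
    HasSum (A.indicator fun x => (p x).toReal) (p.toMeasure A).toReal := by
  have hsum : (p.toMeasure A).toReal = ∑' x, A.indicator (fun x => (p x).toReal) x := by
    have hfinite : ∀ x, A.indicator p x ≠ ⊤ := fun x => by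
      by_cases hx : x ∈ A <;> simp [hx, p.apply_ne_top]
    rw [PMF.toMeasure_apply _ (DiscreteMeasurableSpace.forall_measurableSet A),
      ENNReal.tsum_toReal_eq hfinite]
    refine tsum_congr fun x => ?_
    by_cases hx : x ∈ A <;> simp [hx]
  exact hsum ▸ ((hasSum_toReal p).summable.indicator A).hasSum

theorem tvDist_le_of_hasSum {p q : PMF ℕ} {b : ℕ → ℝ} {B : ℝ} (hb : HasSum b B)
    (h : ∀ x, |(p x).toReal - (q x).toReal| ≤ b x) : tvDist p q ≤ B := by
  refine ciSup_le fun A => ?_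
  rw [← ((hasSum_indicator_toReal_apply p A).sub (hasSum_indicator_toReal_apply q A)).tsum_eq]
  rw [← Real.norm_eq_abs]
  refine tsum_of_norm_bounded hb fun x => ?_
  by_cases hx : x ∈ A
  · simpa [hx] using h x
  · simpa [hx] using (abs_nonneg _).trans (h x)

theorem tendsto_pmf_apply {α ι : Type*} {l : Filter ι} {p : ι → PMF α} {q : PMF α} {x : α}
    {b : ι → ℝ} (hb : Tendsto b l (𝓝 0))
    (h : ∀ᶠ i in l, |(p i x).toReal - (q x).toReal| ≤ b i) :
    Tendsto (fun i => p i x) l (𝓝 (q x)) := by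
  rw [← ENNReal.tendsto_toReal_iff (fun i => (p i).apply_ne_top x) (q.apply_ne_top x),
    tendsto_iff_norm_sub_tendsto_zero]
  exact squeeze_zero' (Eventually.of_forall fun i => norm_nonneg _) h hb

variable {n : ℕ} {lam κ : ℝ} {F : ℕ → ℕ → ℝ}

theorem IsStationary.toReal_map_apply (hlam : 0 ≤ lam) (hlam' : lam ≤ 1 / 100) (hκ : 0 ≤ κ)
    [Nonempty (PerfectMatching n)] {D : (Fin n → ℕ) → PerfectMatching n → ℝ}
    (hD : IsTailSolution lam κ D) {μ : PMF (State n)} (hμ : IsStationary lam κ μ) (i j : Fin n)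
    (x : ℕ) :
    ((μ.map fun s => s.1 i) x).toReal = queueTail D j x - queueTail D j (x + 1) := by
  have hsolution := hμ.isTailSolution_stabilizedTail hlam (by linarith) hκ i
  rw [Supermarket.toReal_map_apply, ← queueTail_stabilizedTail, ← queueTail_stabilizedTail,
    hsolution.queueTail_eq hlam hlam' hκ hD i j]

theorem IsPairTail.exists_isQueueLaw (hlam : 0 ≤ lam) (hlam' : lam ≤ 1 / 2000) (hκ : 0 ≤ κ)
    (hF : IsPairTail lam κ F) (hn : 0 < n) (hn' : Even n) :
    ∃ p : PMF ℕ, IsQueueLaw lam κ n p ∧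
      ∀ x, |(p x).toReal - (F x 0 - F (x + 1) 0)| ≤ 6 / (25 * n) * (1 / 2) ^ x := by
  have := exists_perfectMatching hn'
  obtain ⟨μ, hμ⟩ := exists_isStationary (n := n) hlam (by linarith) hκ
  let i : Fin n := ⟨0, hn⟩
  have hD := hμ.isTailSolution_stabilizedTail hlam (by linarith) hκ i
  have hlaw : ∀ {ν : PMF (State n)}, IsStationary lam κ ν → ∀ j x, ((ν.map fun s => s.1 j) x).toReal
      = queueTail (stabilizedTail μ i) i x - queueTail (stabilizedTail μ i) i (x + 1) :=
    fun hν j x => hν.toReal_map_apply hlam (by linarith) hκ hD j i x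
  refine ⟨μ.map fun s => s.1 i, ⟨⟨μ, hμ⟩, fun ν hν j => PMF.ext fun x => ?_⟩, fun x => ?_⟩
  · rw [← ENNReal.toReal_eq_toReal_iff' (PMF.apply_ne_top _ _) (PMF.apply_ne_top _ _),
      hlaw hν, hlaw hμ]
  · have hx := hD.abs_queueTail_sub_le hlam hlam' hκ hF i
    rw [hlaw hμ, sub_sub_sub_comm]
    refine (abs_sub _ _).trans ((add_le_add (hx x) (hx (x + 1))).trans_eq ?_)
    rw [pow_succ]
    ring

theorem IsPairTail.apply_succ_le (hlam : 0 ≤ lam) (hlam' : lam ≤ 1 / 2000) (hκ : 0 ≤ κ)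
    (hF : IsPairTail lam κ F) (x : ℕ) : F (x + 1) 0 ≤ F x 0 := by
  have hlower : ∀ j : ℕ, -(1 / ((j : ℝ) + 1)) ≤ F x 0 - F (x + 1) 0 := fun j => by
    obtain ⟨p, -, hp⟩ := hF.exists_isQueueLaw hlam hlam' hκ
      (by omega : 0 < 2 * (j + 1)) (even_two_mul (j + 1))
    have hclose : 6 / (25 * ((2 * (j + 1) : ℕ) : ℝ)) * (1 / 2) ^ x ≤ 1 / ((j : ℝ) + 1) := by
      refine (mul_le_of_le_one_right (by positivity)
        (pow_le_one₀ (by norm_num) (by norm_num))).trans ?_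
      rw [div_le_div_iff₀ (by positivity) (by positivity)]
      push_cast
      linarith [(Nat.cast_nonneg j : (0 : ℝ) ≤ j)]
    linarith [(abs_le.1 (hp x)).2, (ENNReal.toReal_nonneg : 0 ≤ (p x).toReal)]
  have hlim : Tendsto (fun j : ℕ => -(1 / ((j : ℝ) + 1))) atTop (𝓝 0) := by
    simpa using (tendsto_one_div_add_atTop_nhds_zero_nat (𝕜 := ℝ)).neg
  exact sub_nonneg.1 (le_of_tendsto' hlim hlower)

theorem IsPairTail.exists_pmf (hlam : 0 ≤ lam) (hlam' : lam ≤ 1 / 2000) (hκ : 0 ≤ κ)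
    (hF : IsPairTail lam κ F) :
    ∃ η : PMF ℕ, ∀ x, (η x).toReal = F x 0 - F (x + 1) 0 := by
  have hnonneg : ∀ x, 0 ≤ F x 0 - F (x + 1) 0 := fun x =>
    sub_nonneg.2 (hF.apply_succ_le hlam hlam' hκ x)
  have hlim : Tendsto (fun x => F x 0) atTop (𝓝 0) :=
    squeeze_zero_norm (fun x => hF.abs_le_pow (by norm_num) x 0)
      (tendsto_pow_atTop_nhds_zero_of_lt_one (by norm_num) (by norm_num))
  refine exists_pmf_toReal_eq hnonneg ((hasSum_iff_tendsto_nat_of_nonneg hnonneg 1).2 ?_)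
  simp only [Finset.sum_range_sub' fun x => F x 0, hF.zero]
  simpa only [sub_zero] using hlim.const_sub 1

end QueueLaw

end Supermarket

theorem mainTheorem10 :
    ∃ lam₀ : ℝ, 0 < lam₀ ∧ ∀ lam : ℝ, 0 < lam → lam < lam₀ → ∀ κ : ℝ, 0 ≤ κ →
      ∃ (π : ℕ → PMF ℕ) (η : PMF ℕ),
        (∀ n : ℕ, 0 < n → Even n → Supermarket.IsQueueLaw lam κ n (π n)) ∧
        (∀ x : ℕ, Filter.Tendsto (fun n => π n x)
          (Filter.atTop ⊓ Filter.principal {n : ℕ | Even n}) (nhds (η x))) ∧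
        ∀ n : ℕ, 0 < n → Even n → Supermarket.tvDist (π n) η ≤ 1 / (n : ℝ) := by
  refine ⟨1 / 2000, by norm_num, fun lam hlam hlam' κ hκ => ?_⟩
  obtain ⟨F, hF⟩ := Supermarket.exists_isPairTail hlam.le hlam'.le hκ
  obtain ⟨η, hη⟩ := hF.exists_pmf hlam.le hlam'.le hκ
  choose! π hlaw hclose using fun n hn hn' =>
    hF.exists_isQueueLaw (n := n) hlam.le hlam'.le hκ hn hn'
  simp only [← hη] at hclose
  refine ⟨π, η, hlaw, fun x => ?_, fun n hn hn' => ?_⟩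
  · have hlim : Filter.Tendsto (fun n : ℕ => 6 / 25 * (1 / 2 : ℝ) ^ x * (1 / (n : ℝ)))
        (Filter.atTop ⊓ Filter.principal {n : ℕ | Even n}) (nhds 0) := by
      simpa only [mul_zero] using
        ((tendsto_one_div_atTop_nhds_zero_nat (𝕜 := ℝ)).mono_left inf_le_left).const_mul _
    refine Supermarket.tendsto_pmf_apply hlim ?_
    filter_upwards [Filter.mem_inf_of_left (Filter.eventually_gt_atTop 0),
      Filter.mem_inf_of_right (Filter.mem_principal_self _)] with n hn hn'
    exact (hclose n hn hn' x).trans_eq (by ring)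
  · refine (Supermarket.tvDist_le_of_hasSum (hasSum_geometric_two.mul_left _)
      (hclose n hn hn')).trans ?_
    have hpos : (0 : ℝ) < n := by exact_mod_cast hn
    rw [← mul_comm 2, ← mul_div_assoc, div_le_div_iff₀ (by positivity) hpos]
    linarith
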